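/- There are triangulated models $M_0, M_1, M_2, \dots$ (finite sets of triangles meeting edge-to-edge), each having the topology of a sphere with a single hole, and a constant $C$ with the following properties. $M_k$ is the recursive triangulation of the regular $(3\cdot 2^k)$-gon: $M_0$ is a single equilateral triangle, and, for $k\ge 1$, $M_k$ consists of $3\cdot 2^{k-1}$ outer triangles, each formed by three consecutive vertices and together cutting off every second vertex of the $(3\cdot 2^k)$-gon, and of a copy of $M_{k-1}$ that triangulates the central regular $(3\cdot 2^{k-1})$-gon on the remaining vertices. $M_k$ has $n_k=3(2^k-1)+1$ triangles (so the family is infinite), and its dual graph (nodes are the triangles; two triangles are adjacent when they share an edge) is a complete tree of height $k$: all nodes have distance at most $k$ from a root, the nodes at distance less than $k$ have degree three, and the nodes at distance $k$ are leaves. For every $k$ and every subdivision of $M_k$ (a finite triangulation of the same polygon, with triangles meeting edge-to-edge, in which every triangle lies in a triangle of $M_k$), every single triangle strip of the subdivision, that is, every ordering of all its triangles without repetition in which consecutive triangles share an edge, has at least $$3n_k-4\log_2 n_k-C$$ triangles. -/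

import Mathlib

namespace TriangleStrips

open Geometry

/-! ### Triangulated models, their dual graphs, subdivisions and single strips -/

section Models

variable {E : Type*} [AddCommGroup E] [Module ℝ E]

/-- The triangles of a simplicial complex, each given by its set of three vertices. -/
def triangles (K : SimplicialComplex ℝ E) : Set (Finset E) :=
  {t | t ∈ K.faces ∧ t.card = 3}

/-- The number of triangles of a simplicial complex (used for finite complexes only). -/
noncomputable def numTriangles (K : SimplicialComplex ℝ E) : ℕ :=
  (triangles K).ncard

/-- A triangulated model: finitely many triangles meeting edge-to-edge, together with their edges
and vertices, i.e. a finite simplicial complex all of whose faces are faces of triangles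
of the complex. -/
def IsTriangulatedModel (K : SimplicialComplex ℝ E) : Prop :=
  K.faces.Finite ∧ K.faces.Nonempty ∧ ∀ s ∈ K.faces, ∃ t ∈ triangles K, s ⊆ t

/-- The dual graph: its nodes are the triangles, and two different triangles are adjacent when
they have an edge in common. -/
def dualGraph (K : SimplicialComplex ℝ E) : SimpleGraph (triangles K) where
  Adj s t := s ≠ t ∧ ∃ e ∈ K.faces, e.card = 2 ∧ e ⊆ s.1 ∧ e ⊆ t.1
  symm := ⟨fun _ _ h => ⟨h.1.symm, h.2.imp fun _ he => ⟨he.1, he.2.1, he.2.2.2, he.2.2.1⟩⟩⟩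
  loopless := ⟨fun _ h => h.1 rfl⟩

/-- `L` is a (finite) subdivision of `K`: both complexes have the same underlying space, and
each simplex of `L` lies in a simplex of `K`. -/
def IsSubdivision (L K : SimplicialComplex ℝ E) : Prop :=
  L.faces.Finite ∧ L.space = K.space ∧
    ∀ s ∈ L.faces, ∃ t ∈ K.faces, convexHull ℝ (s : Set E) ⊆ convexHull ℝ (t : Set E)

open Classical in
/-- A single triangle strip of `K`: a sequence of triangles of `K`, each one sharing an edge with
the next one, that contains every triangle of `K` exactly once. -/
def IsSingleStrip (K : SimplicialComplex ℝ E) {s t : triangles K}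
    (p : (dualGraph K).Walk s t) : Prop :=
  p.IsHamiltonian

end Models

/-! ### Topology and shape of the dual tree -/

/-- The sphere with a single hole: the unit sphere of three-dimensional space from which an open
hemisphere has been removed. -/
def sphereWithHole : Set (EuclideanSpace ℝ (Fin 3)) :=
  {x | ‖x‖ = 1 ∧ x 2 ≤ 0}

/-- `G` is the complete tree of height `k` in which each node that is not a leaf has degree three:
for some root, all nodes have distance at most `k` from the root, the nodes at distance less
than `k` have degree three, and those at distance `k` are leaves. -/
def IsCompleteCubicTree {V : Type*} (G : SimpleGraph V) (k : ℕ) : Prop :=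
  G.IsTree ∧ ∃ r : V, ∀ v : V, G.dist r v ≤ k ∧
    (G.dist r v < k → (G.neighborSet v).ncard = 3) ∧
    (G.dist r v = k → (G.neighborSet v).ncard ≤ 1)

/-! ### The recursive triangulations of regular polygons -/

/-- The `i`-th vertex of the regular `N`-gon inscribed in the unit circle, starting from `(1, 0)`
and in counterclockwise order. -/
noncomputable def polygonVertex (N i : ℕ) : EuclideanSpace ℝ (Fin 2) :=
  !₂[Real.cos (2 * Real.pi * i / N), Real.sin (2 * Real.pi * i / N)]

open Classical in
/-- The triangle spanned by the vertices `a`, `b`, `c` of the regular `N`-gon. -/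
noncomputable def polygonTriangle (N a b c : ℕ) : Finset (EuclideanSpace ℝ (Fin 2)) :=
  {polygonVertex N a, polygonVertex N b, polygonVertex N c}

/-- The triangles of the recursive triangulation of the regular `3 * 2 ^ k`-gon. For `k = 0` there
is a single equilateral triangle. The triangulation of the `3 * 2 ^ (k + 1)`-gon has
`3 * 2 ^ k` outer triangles, which cut off every second vertex; they surround the regular
`3 * 2 ^ k`-gon on the remaining vertices, which is triangulated recursively. -/
noncomputable def recursiveTriangles : ℕ → Set (Finset (EuclideanSpace ℝ (Fin 2)))
  | 0 => {polygonTriangle 3 0 1 2}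
  | k + 1 =>
      {t | ∃ i < 3 * 2 ^ k,
        t = polygonTriangle (3 * 2 ^ (k + 1)) (2 * i) (2 * i + 1) (2 * i + 2)} ∪
      recursiveTriangles k

end TriangleStrips

/-! Lower bound. Let `K` be the model with `n` triangles and `L` a subdivision. Fix a linear
functional `f` injective on the vertices of `L`; then a triangle of `L` has a unique vertex of
median value. If the level line of `f` through a vertex `v` of `L` passes from `v` straight into the
interior of a triangle `T` of `K`, some triangle of `L` inside `T` has median `v`. This happens when
`v` is the median vertex of `T`, and whenever `v` lies in the relative interior of a side of `T`.
Since a triangle of `L` lies in only one triangle of `K` and has only one median, `L` has at least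
`n` triangles plus one for each pair of a triangle and a subdivided inner side of it
(`card_add_card_split_le`). Inner sides are the edges of the dual tree, so there are `2(n - 1)`
pairs of a triangle and an inner side.

Every edge of the tree is a bridge. If it does not separate the triangles of `K` holding the ends of
the strip, the strip crosses it at least twice, leaving two different triangles on the same side of
it (`exists_two_crossings`). An undivided side, however, belongs to a single triangle of `L` on each
side (`eq_of_side_subset`). So undivided sides lie on a tree path of length at most `2k`, which
spoils at most `4k` pairs. The strip has at least `n + 2(n - 1) - 4k` triangles, and `2 ^ k ≤ n`.

Model. Each outer triangle is separated from all other triangles by the chord through its two even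
vertices (`cutoff`); this yields both the face-to-face condition and, adding odd vertices one by
one, the covering of the polygon. A side is determined by its level and number
(`polygonSide_injective`), so adjacency becomes arithmetic on positions, and the dual graph is given
by a parent function. -/

namespace TriangleStrips

open Geometry Filter Topology

/-! ### Barycentric coordinates and rays entering a triangle -/

section Barycentric

variable {V : Type*} [AddCommGroup V] [Module ℝ V]

/-- `c a`, for `a ∈ T`, are the barycentric coordinates with respect to the simplex `T`. -/
structure IsBarycentric (T : Finset V) (c : V → V →ᵃ[ℝ] ℝ) : Prop where
  self : ∀ a ∈ T, c a a = 1
  ne : ∀ a ∈ T, ∀ b ∈ T, a ≠ b → c a b = 0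
  sum : ∀ x, ∑ a ∈ T, c a x = 1
  comb : ∀ x, ∑ a ∈ T, c a x • a = x

theorem exists_isBarycentric [FiniteDimensional ℝ V] {T : Finset V}
    (hT : AffineIndependent ℝ ((↑) : T → V)) (hcard : T.card = Module.finrank ℝ V + 1) :
    ∃ c, IsBarycentric T c := by
  classical
  have htop : affineSpan ℝ (Set.range ((↑) : T → V)) = ⊤ := by
    rw [hT.affineSpan_eq_top_iff_card_eq_finrank_add_one]
    simpa using hcard
  let b : AffineBasis T ℝ V := ⟨(↑), hT, htop⟩
  have hb : ∀ i : T, b i = (i : V) := fun i => rfl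
  -- Off `T` the value `0` is a dummy: the required properties involve only `a ∈ T`.
  refine ⟨fun a => if h : a ∈ T then b.coord ⟨a, h⟩ else 0, ?_, ?_, ?_, ?_⟩
  · intro a ha
    have := b.coord_apply_eq ⟨a, ha⟩
    rw [hb] at this
    simpa only [ha, dif_pos] using this
  · intro a ha a' ha' hne
    have := b.coord_apply_ne (i := ⟨a, ha⟩) (j := ⟨a', ha'⟩) (by simpa using hne)
    rw [hb] at this
    simpa only [ha, dif_pos] using this
  · intro x
    rw [← Finset.sum_coe_sort]
    simpa using b.sum_coord_apply_eq_one x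
  · intro x
    rw [← Finset.sum_coe_sort]
    simpa [hb] using b.linear_combination_coord_eq_self x

namespace IsBarycentric

variable {T U : Finset V} {c : V → V →ᵃ[ℝ] ℝ} {x a : V}

theorem eq_zero_of_mem_convexHull (h : IsBarycentric T c) (hU : U ⊆ T) (ha : a ∈ T) (haU : a ∉ U)
    (hx : x ∈ convexHull ℝ (U : Set V)) : c a x = 0 := by
  have hconv : Convex ℝ {y | c a y = 0} := (convex_singleton (0 : ℝ)).affine_preimage (c a)
  exact convexHull_min (fun y hy => h.ne a ha y (hU hy) fun e => haU (e ▸ hy)) hconv hx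

theorem nonneg_of_mem_convexHull (h : IsBarycentric T c) (ha : a ∈ T)
    (hx : x ∈ convexHull ℝ (T : Set V)) : 0 ≤ c a x := by
  have hconv : Convex ℝ {y | 0 ≤ c a y} := (convex_Ici (0 : ℝ)).affine_preimage (c a)
  refine convexHull_min (fun y hy => ?_) hconv hx
  by_cases e : a = y
  · subst e; simp [h.self a ha]
  · simp [h.ne a ha y hy e]

theorem mem_convexHull_of_subset (h : IsBarycentric T c) (hU : U ⊆ T)
    (hnn : ∀ a ∈ T, 0 ≤ c a x) (hz : ∀ a ∈ T, a ∉ U → c a x = 0) :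
    x ∈ convexHull ℝ (U : Set V) := by
  rw [Finset.mem_convexHull']
  refine ⟨fun a => c a x, fun a ha => hnn a (hU ha), ?_, ?_⟩
  · rw [Finset.sum_subset hU hz, h.sum]
  · rw [Finset.sum_subset hU fun a ha ha' => by
      simp only [hz a ha ha', zero_smul], h.comb]

theorem mem_convexHull_iff (h : IsBarycentric T c) :
    x ∈ convexHull ℝ (T : Set V) ↔ ∀ a ∈ T, 0 ≤ c a x :=
  ⟨fun hx _ ha => h.nonneg_of_mem_convexHull ha hx,
    fun hx => h.mem_convexHull_of_subset subset_rfl hx fun _ h1 h2 => (h2 h1).elim⟩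

/-- An affine functional is the barycentric mean of its values at the vertices. -/
theorem ext_map (h : IsBarycentric T c) {f g : V →ᵃ[ℝ] ℝ} (hfg : ∀ a ∈ T, f a = g a) (x : V) :
    f x = g x := by
  have key : ∀ k : V →ᵃ[ℝ] ℝ, k x = ∑ a ∈ T, c a x * k a := by
    intro k
    have hk : ∀ y, k y = k.linear y + k 0 := fun y => by
      simpa using k.map_vadd 0 y
    rw [hk x]
    conv_lhs => rw [← h.comb x]
    rw [map_sum]
    simp only [map_smul, smul_eq_mul]
    have : ∑ a ∈ T, c a x * k a = ∑ a ∈ T, c a x * k.linear a + (∑ a ∈ T, c a x) * k 0 := by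
      rw [Finset.sum_mul, ← Finset.sum_add_distrib]
      exact Finset.sum_congr rfl fun a _ => by rw [hk a]; ring
    rw [this, h.sum, one_mul]
  rw [key f, key g]
  exact Finset.sum_congr rfl fun a ha => by rw [hfg a ha]

theorem apply_add_smul (g : V →ᵃ[ℝ] ℝ) (v w : V) (ε : ℝ) :
    g (v + ε • w) = g v + ε * g.linear w := by
  have := g.map_vadd v (ε • w)
  simp only [vadd_eq_add, map_smul, smul_eq_mul] at this
  rw [add_comm v, this, add_comm]

/-- Continuity at `ε = 0` in the first case, a positive slope in the second. -/
theorem eventually_pos {g : V →ᵃ[ℝ] ℝ} {v w : V} (h : 0 < g v ∨ g v = 0 ∧ 0 < g.linear w) :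
    ∀ᶠ ε in 𝓝[>] (0 : ℝ), 0 < g (v + ε • w) := by
  simp only [apply_add_smul]
  rcases h with h | ⟨h, h'⟩
  · have : Tendsto (fun ε : ℝ => g v + ε * g.linear w) (𝓝 0) (𝓝 (g v + 0 * g.linear w)) := by
      apply Continuous.tendsto
      fun_prop
    rw [zero_mul, add_zero] at this
    exact (this.mono_left nhdsWithin_le_nhds).eventually (lt_mem_nhds h)
  · filter_upwards [self_mem_nhdsWithin] with ε hε
    rw [h, zero_add]
    exact mul_pos hε h'

theorem linear_comb (g : V →ᵃ[ℝ] ℝ) (a b d : V) {α β γ : ℝ} (h : α + β + γ = 0) :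
    g.linear (α • a + β • b + γ • d) = α * g a + β * g b + γ * g d := by
  have hk : ∀ y, g y = g.linear y + g 0 := fun y => by simpa using g.map_vadd 0 y
  simp only [map_add, map_smul, smul_eq_mul]
  rw [hk a, hk b, hk d]
  linear_combination (-g 0) * h

/-- From a vertex or from a point on a side of a triangle, one can go into the interior within a
level line of a linear functional, provided the vertex has the median value, respectively the
functional is not constant on the side. -/
theorem exists_inward {a b d v : V} [DecidableEq V] (h : IsBarycentric ({a, b, d} : Finset V) c)
    (hab : a ≠ b) (had : a ≠ d) (hbd : b ≠ d) (f : V →ₗ[ℝ] ℝ) {σ : ℝ}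
    (ha : 0 < c a v ∨ c a v = 0 ∧ 0 < σ * (f b - f d))
    (hb : 0 < c b v ∨ c b v = 0 ∧ 0 < σ * (f d - f a))
    (hd : 0 < c d v ∨ c d v = 0 ∧ 0 < σ * (f a - f b)) :
    ∃ w, f w = 0 ∧ ∀ᶠ ε in 𝓝[>] (0 : ℝ), ∀ x ∈ ({a, b, d} : Finset V), 0 < c x (v + ε • w) := by
  -- The coefficients sum to zero, so they are the slopes of the barycentric coordinates along this
  -- vector; `f` cancels cyclically on it. The sign of `σ` orients the level line.
  refine ⟨(σ * (f b - f d)) • a + (σ * (f d - f a)) • b + (σ * (f a - f b)) • d, ?_, ?_⟩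
  · simp only [map_add, map_smul, smul_eq_mul]; ring
  · have hs : σ * (f b - f d) + σ * (f d - f a) + σ * (f a - f b) = 0 := by ring
    have ma : a ∈ ({a, b, d} : Finset V) := by simp
    have mb : b ∈ ({a, b, d} : Finset V) := by simp
    have md : d ∈ ({a, b, d} : Finset V) := by simp
    have la := linear_comb (c a) a b d hs
    have lb := linear_comb (c b) a b d hs
    have ld := linear_comb (c d) a b d hs
    rw [h.self a ma, h.ne a ma b mb hab, h.ne a ma d md had] at la
    rw [h.self b mb, h.ne b mb a ma hab.symm, h.ne b mb d md hbd] at lb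
    rw [h.self d md, h.ne d md b mb hbd.symm, h.ne d md a ma had.symm] at ld
    simp only [mul_one, mul_zero, add_zero, zero_add] at la lb ld
    rw [← la] at ha
    rw [← lb] at hb
    rw [← ld] at hd
    filter_upwards [eventually_pos ha, eventually_pos hb, eventually_pos hd] with ε h1 h2 h3
    intro x hx
    simp only [Finset.mem_insert, Finset.mem_singleton] at hx
    rcases hx with rfl | rfl | rfl <;> assumption

end IsBarycentric

/-- If `f v` were the minimum over `D`, a convex combination with value `f v` would, by injectivity,
put all its weight on `v`. -/
theorem exists_lt_of_mem_convexHull {D : Finset V} {f : V →ₗ[ℝ] ℝ} (hf : Set.InjOn f D) {v x : V}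
    (hv : v ∈ D) (hx : x ∈ convexHull ℝ (D : Set V)) (hne : x ≠ v) (hfx : f x = f v) :
    ∃ a ∈ D, f a < f v := by
  by_contra! hcon
  obtain ⟨w, hw0, hw1, rfl⟩ := Finset.mem_convexHull'.1 hx
  have hsum : ∑ y ∈ D, w y * (f y - f v) = 0 := by
    have hfx : ∑ y ∈ D, w y * f y = f v := by simpa using hfx
    simp only [mul_sub, Finset.sum_sub_distrib, ← Finset.sum_mul, hw1, hfx]
    ring
  rw [Finset.sum_eq_zero_iff_of_nonneg
    fun y hy => mul_nonneg (hw0 y hy) (sub_nonneg.2 (hcon y hy))] at hsum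
  have hz : ∀ y ∈ D, y ≠ v → w y = 0 := by
    intro y hy hyv
    refine (mul_eq_zero.1 (hsum y hy)).resolve_right fun h => hyv (hf hy hv (sub_eq_zero.1 h))
  apply hne
  rw [Finset.sum_eq_single_of_mem v hv fun y hy h => by rw [hz y hy h, zero_smul]]
  rw [Finset.sum_eq_single_of_mem v hv hz] at hw1
  rw [hw1, one_smul]

theorem card_le_of_convexHull_subset {D U : Finset V} (hD : AffineIndependent ℝ ((↑) : D → V))
    (h : convexHull ℝ (D : Set V) ⊆ convexHull ℝ (U : Set V)) : D.card ≤ U.card :=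
  hD.card_le_card_of_subset_affineSpan
    (((subset_convexHull ℝ _).trans h).trans (convexHull_subset_affineSpan _))

end Barycentric

/-! ### Simplices met by a level line -/

section Median

variable {V : Type*} [NormedAddCommGroup V] [NormedSpace ℝ V]

/-- In a finite complex that covers the beginning of a ray within a level line of a functional
that is injective on the vertices, the starting vertex is the median of some simplex. -/
theorem exists_face_median {L : SimplicialComplex ℝ V} (hfin : L.faces.Finite)
    {f : V →ₗ[ℝ] ℝ} (hf : Set.InjOn f L.vertices) {v w : V} (hv : v ∈ L.vertices) (hfw : f w = 0)
    (hw : w ≠ 0) {P : V → Prop}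
    (hcov : ∀ᶠ ε in 𝓝[>] (0 : ℝ), v + ε • w ∈ L.space ∧ P (v + ε • w)) :
    ∃ D ∈ L.faces, v ∈ D ∧ (∃ x ∈ convexHull ℝ (D : Set V), P x) ∧
      (∃ a ∈ D, f a < f v) ∧ ∃ b ∈ D, f v < f b := by
  -- Pigeonhole over the finitely many faces: if each were eventually missed by the ray, all would
  -- be missed at once.
  have h1 : ∃ D ∈ L.faces, ∃ᶠ ε in 𝓝[>] (0 : ℝ), v + ε • w ∈ convexHull ℝ (D : Set V) := by
    by_contra! hcon
    have := (hfin.eventually_all).2 hcon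
    obtain ⟨ε, h2, h3⟩ := (this.and hcov).exists
    obtain ⟨D, hD, hm⟩ := SimplicialComplex.mem_space_iff.1 h3.1
    exact h2 D hD hm
  obtain ⟨D, hD, hfreq⟩ := h1
  have hcl : IsClosed (convexHull ℝ (D : Set V)) := (D.finite_toSet.isCompact_convexHull ℝ).isClosed
  have htend : Tendsto (fun ε : ℝ => v + ε • w) (𝓝[>] 0) (𝓝 v) := by
    have : Tendsto (fun ε : ℝ => v + ε • w) (𝓝 0) (𝓝 (v + (0 : ℝ) • w)) := by
      apply Continuous.tendsto
      fun_prop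
    rw [zero_smul, add_zero] at this
    exact this.mono_left nhdsWithin_le_nhds
  -- The hull is closed, so it contains the limit `v`; a vertex of the complex lying in a face is a
  -- vertex of that face.
  have hvD : v ∈ D := (SimplicialComplex.vertex_mem_convexHull_iff hv hD).1
    (hcl.mem_of_frequently_of_tendsto hfreq htend)
  obtain ⟨ε, h2, h3, hε⟩ := (hfreq.and_eventually (hcov.and self_mem_nhdsWithin)).exists
  have hne : v + ε • w ≠ v := by
    simpa [hw] using (ne_of_gt hε : ε ≠ 0)
  have hfx : f (v + ε • w) = f v := by simp [hfw]
  have hDv : (D : Set V) ⊆ L.vertices := fun y hy =>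
    L.down_closed hD (Finset.singleton_subset_iff.2 hy) (Finset.singleton_nonempty _)
  refine ⟨D, hD, hvD, ⟨_, h2, h3.2⟩, exists_lt_of_mem_convexHull (hf.mono hDv) hvD h2 hne hfx, ?_⟩
  obtain ⟨b, hb, hlt⟩ := exists_lt_of_mem_convexHull (f := -f) (v := v)
    (fun x hx y hy h => hf (hDv hx) (hDv hy) (by simpa using h)) hvD h2 hne (by simp [hfx])
  exact ⟨b, hb, by simpa using hlt⟩

end Median

/-! ### Triangles of a subdivision inside a triangle of the model -/

section Planar

/-- Two triangles with a common edge intersect exactly in this edge. -/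
theorem coe_inter_eq_of_subset {V : Type*} {T T' e : Finset V} (hT : T.card = 3) (hT' : T'.card = 3)
    (hne : T ≠ T') (he : e.card = 2) (h1 : e ⊆ T) (h2 : e ⊆ T') : (T ∩ T' : Set V) = e := by
  classical
  rw [← Finset.coe_inter]
  congr 1
  refine (Finset.eq_of_subset_of_card_le (Finset.subset_inter h1 h2) ?_).symm
  by_contra! hlt
  have h3 : T ∩ T' = T := Finset.eq_of_subset_of_card_le Finset.inter_subset_left (by omega)
  have h4 : T ∩ T' = T' := Finset.eq_of_subset_of_card_le Finset.inter_subset_right (by omega)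
  exact hne (h3.symm.trans h4)

variable {V : Type*} [NormedAddCommGroup V] [NormedSpace ℝ V]

theorem _root_.Geometry.SimplicialComplex.coe_subset_vertices {K : SimplicialComplex ℝ V}
    {s : Finset V} (hs : s ∈ K.faces) : (s : Set V) ⊆ K.vertices := fun _ hy =>
  K.down_closed hs (Finset.singleton_subset_iff.2 hy) (Finset.singleton_nonempty _)

theorem exists_isBarycentric_triangle (h2 : Module.finrank ℝ V = 2) {K : SimplicialComplex ℝ V}
    {T : Finset V} (hT : T ∈ triangles K) : ∃ c, IsBarycentric T c := by
  have : FiniteDimensional ℝ V := Module.finite_of_finrank_eq_succ h2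
  exact exists_isBarycentric (K.indep hT.1) (by rw [hT.2, h2])

theorem card_face_le_three (h2 : Module.finrank ℝ V = 2) {K : SimplicialComplex ℝ V}
    {s : Finset V} (hs : s ∈ K.faces) : s.card ≤ 3 := by
  have : FiniteDimensional ℝ V := Module.finite_of_finrank_eq_succ h2
  have := (K.indep hs).card_le_finrank_succ
  have h3 := Submodule.finrank_le (vectorSpan ℝ (Set.range ((↑) : s → V)))
  simp only [Fintype.card_coe] at this
  omega

variable {K L : SimplicialComplex ℝ V}

/-- A triangle that lies in two triangles of a complex lies in only one. -/
theorem eq_of_convexHull_subset {T T' D : Finset V} (hT : T ∈ triangles K) (hT' : T' ∈ triangles K)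
    (hD : D ∈ triangles L) (h : convexHull ℝ (D : Set V) ⊆ convexHull ℝ (T : Set V))
    (h' : convexHull ℝ (D : Set V) ⊆ convexHull ℝ (T' : Set V)) : T = T' := by
  classical
  have hsub := (Set.subset_inter h h').trans (K.inter_subset_convexHull hT.1 hT'.1)
  rw [← Finset.coe_inter] at hsub
  have hc := card_le_of_convexHull_subset (L.indep hD.1) hsub
  have hT3 := hT.2
  have hT3' := hT'.2
  have hD3 := hD.2
  have h3 : T ∩ T' = T := Finset.eq_of_subset_of_card_le Finset.inter_subset_left (by omega)
  have h4 : T ∩ T' = T' := Finset.eq_of_subset_of_card_le Finset.inter_subset_right (by omega)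
  exact h3.symm.trans h4

theorem exists_owner (hK : IsTriangulatedModel K) (hLK : IsSubdivision L K) {s : Finset V}
    (hs : s ∈ L.faces) : ∃ T ∈ triangles K, convexHull ℝ (s : Set V) ⊆ convexHull ℝ (T : Set V) := by
  obtain ⟨t, ht, hst⟩ := hLK.2.2 s hs
  obtain ⟨T, hT, htT⟩ := hK.2.2 t ht
  exact ⟨T, hT, hst.trans (convexHull_mono (Finset.coe_subset.2 htT))⟩

/-- A vertex `v` of `T` is an extreme point: its coordinate is below `1` elsewhere in `T`. A face of
`L` inside `T` without the vertex `v` therefore cannot contain `v` in its hull. -/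
theorem vertices_subset (h2 : Module.finrank ℝ V = 2) (hK : IsTriangulatedModel K)
    (hLK : IsSubdivision L K) : K.vertices ⊆ L.vertices := by
  intro v hv
  have hvL : v ∈ L.space := hLK.2.1 ▸ SimplicialComplex.vertices_subset_space hv
  obtain ⟨s, hs, hvs⟩ := SimplicialComplex.mem_space_iff.1 hvL
  obtain ⟨T, hT, hsT⟩ := exists_owner hK hLK hs
  have hvT : v ∈ T := (SimplicialComplex.vertex_mem_convexHull_iff hv hT.1).1 (hsT hvs)
  obtain ⟨c, hc⟩ := exists_isBarycentric_triangle h2 hT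
  suffices v ∈ s from SimplicialComplex.coe_subset_vertices hs this
  by_contra hns
  have hlt : ∀ y ∈ s, c v y < 1 := by
    intro y hy
    have hyT := hsT (subset_convexHull ℝ _ hy)
    have hnn := hc.mem_convexHull_iff.1 hyT
    by_contra! hge
    have hz : ∀ a ∈ T, a ∉ ({v} : Finset V) → c a y = 0 := by
      classical
      intro a ha hav
      have hsum := hc.sum y
      rw [← Finset.add_sum_erase T _ hvT] at hsum
      have h0 : ∑ x ∈ T.erase v, c x y = 0 := by
        have : 0 ≤ ∑ x ∈ T.erase v, c x y :=
          Finset.sum_nonneg fun x hx => hnn x (Finset.mem_of_mem_erase hx)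
        linarith
      exact (Finset.sum_eq_zero_iff_of_nonneg
        fun x hx => hnn x (Finset.mem_of_mem_erase hx)).1 h0 a
          (Finset.mem_erase.2 ⟨by simpa using hav, ha⟩)
    have := hc.mem_convexHull_of_subset (Finset.singleton_subset_iff.2 hvT) hnn hz
    simp only [Finset.coe_singleton, convexHull_singleton, Set.mem_singleton_iff] at this
    exact hns (this ▸ hy)
  have hconv : Convex ℝ {y | c v y < 1} := (convex_Iio (1 : ℝ)).affine_preimage (c v)
  have hvv : c v v < 1 := convexHull_min (fun y hy => hlt y hy) hconv hvs
  rw [hc.self v hvT] at hvv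
  exact lt_irrefl _ hvv

/-- `v` has the median value of `f` among the vertices of the triangle `D`. -/
def IsMedian (f : V →ₗ[ℝ] ℝ) (D : Finset V) (v : V) : Prop :=
  v ∈ D ∧ (∃ a ∈ D, f a < f v) ∧ ∃ b ∈ D, f v < f b

theorem IsMedian.unique {f : V →ₗ[ℝ] ℝ} {D : Finset V} {v v' : V} (hD : D.card = 3)
    (h : IsMedian f D v) (h' : IsMedian f D v') : v = v' := by
  classical
  obtain ⟨hv, ⟨a, ha, hav⟩, b, hb, hvb⟩ := h
  obtain ⟨hv', ⟨a', ha', hav'⟩, b', hb', hvb'⟩ := h'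
  have hav0 : a ≠ v := by rintro rfl; exact lt_irrefl _ hav
  have hvb0 : v ≠ b := by rintro rfl; exact lt_irrefl _ hvb
  have hab0 : a ≠ b := by rintro rfl; exact lt_asymm hav hvb
  have hDe : ({a, v, b} : Finset V) = D := by
    refine Finset.eq_of_subset_of_card_le ?_ ?_
    · simp [Finset.insert_subset_iff, ha, hv, hb]
    · rw [hD, Finset.card_eq_three.2 ⟨a, v, b, hav0, hab0, hvb0, rfl⟩]
  subst hDe
  simp only [Finset.mem_insert, Finset.mem_singleton] at hv' ha' hb'
  rcases hv' with rfl | rfl | rfl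
  · rcases ha' with rfl | rfl | rfl <;> linarith
  · rfl
  · rcases hb' with rfl | rfl | rfl <;> linarith

/-- The face of `L` followed by the ray reaches interior points of `T`, so it lies in `T`; three
different values of `f` make it a triangle. -/
theorem exists_triangle_median (h2 : Module.finrank ℝ V = 2) (hK : IsTriangulatedModel K)
    (hLK : IsSubdivision L K) {f : V →ₗ[ℝ] ℝ} (hf : Set.InjOn f L.vertices) {T : Finset V}
    (hT : T ∈ triangles K) {c : V → V →ᵃ[ℝ] ℝ} (hc : IsBarycentric T c) {v w : V}
    (hv : v ∈ L.vertices) (hfw : f w = 0) (hz : ∃ x ∈ T, c x v = 0)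
    (hw : ∀ᶠ ε in 𝓝[>] (0 : ℝ), ∀ x ∈ T, 0 < c x (v + ε • w)) :
    ∃ D ∈ triangles L, convexHull ℝ (D : Set V) ⊆ convexHull ℝ (T : Set V) ∧ IsMedian f D v := by
  classical
  -- With `w = 0` the point `v` itself would be interior, against `hz`.
  have hw0 : w ≠ 0 := by
    rintro rfl
    obtain ⟨ε, hε⟩ := hw.exists
    obtain ⟨x, hx, hx0⟩ := hz
    have := hε x hx
    simp [hx0] at this
  obtain ⟨D, hD, hvD, ⟨x, hxD, hxT⟩, hlt⟩ := exists_face_median hLK.1 hf hv hfw hw0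
    (P := fun y => ∀ x ∈ T, 0 < c x y) (hw.mono fun ε hε => ⟨by
      rw [hLK.2.1]
      exact SimplicialComplex.convexHull_subset_space hT.1
        (hc.mem_convexHull_iff.2 fun a ha => (hε a ha).le), hε⟩)
  obtain ⟨T', hT', hDT'⟩ := exists_owner hK hLK hD
  -- All coordinates of `x` with respect to `T` are positive, so `x` lies in no proper face of `T`,
  -- in particular not in a proper `T ∩ T'`.
  have hTT' : T ⊆ T' := by
    intro a ha
    by_contra hn
    have hx : x ∈ convexHull ℝ (T ∩ T' : Set V) := K.inter_subset_convexHull hT.1 hT'.1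
      ⟨hc.mem_convexHull_iff.2 fun a ha => (hxT a ha).le, hDT' hxD⟩
    rw [← Finset.coe_inter] at hx
    have h0 := hc.eq_zero_of_mem_convexHull Finset.inter_subset_left ha (by simp [hn]) hx
    have := hxT a ha
    linarith
  have hTe : T = T' := Finset.eq_of_subset_of_card_le hTT' (by rw [hT.2, hT'.2])
  refine ⟨D, ⟨hD, le_antisymm (card_face_le_three h2 hD) ?_⟩, hTe ▸ hDT', hvD, hlt⟩
  obtain ⟨⟨a, ha, hav⟩, b, hb, hvb⟩ := hlt
  have hav0 : a ≠ v := by rintro rfl; exact lt_irrefl _ hav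
  have hvb0 : v ≠ b := by rintro rfl; exact lt_irrefl _ hvb
  have hab0 : a ≠ b := by rintro rfl; exact lt_asymm hav hvb
  rw [← Finset.card_eq_three.2 ⟨a, v, b, hav0, hab0, hvb0, rfl⟩]
  refine Finset.card_le_card ?_
  simp [Finset.insert_subset_iff, ha, hvD, hb]

theorem exists_sorted_triple [DecidableEq V] {f : V →ₗ[ℝ] ℝ} {T : Finset V} (hT : T.card = 3)
    (hf : Set.InjOn f T) : ∃ a b d, T = {a, b, d} ∧ f a < f b ∧ f b < f d := by
  obtain ⟨a, b, d, hab, had, hbd, rfl⟩ := Finset.card_eq_three.1 hT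
  have h1 : f a ≠ f b := fun h => hab (hf (by simp) (by simp) h)
  have h2 : f a ≠ f d := fun h => had (hf (by simp) (by simp) h)
  have h3 : f b ≠ f d := fun h => hbd (hf (by simp) (by simp) h)
  rcases h1.lt_or_gt with h1 | h1 <;> rcases h2.lt_or_gt with h2 | h2 <;>
    rcases h3.lt_or_gt with h3 | h3
  · exact ⟨a, b, d, rfl, h1, h3⟩
  · exact ⟨a, d, b, by grind, h2, h3⟩
  · linarith
  · exact ⟨d, a, b, by grind, h2, h1⟩
  · exact ⟨b, a, d, by grind, h1, h2⟩
  · linarith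
  · exact ⟨b, d, a, by grind, h3, h2⟩
  · exact ⟨d, b, a, by grind, h3, h1⟩

/-- The level line through the median vertex separates the other two vertices, hence enters the
triangle. -/
theorem exists_triangle_median_vertex (h2 : Module.finrank ℝ V = 2) (hK : IsTriangulatedModel K)
    (hLK : IsSubdivision L K) {f : V →ₗ[ℝ] ℝ} (hf : Set.InjOn f L.vertices) {T : Finset V}
    (hT : T ∈ triangles K) : ∃ D ∈ triangles L, ∃ v ∈ T,
      convexHull ℝ (D : Set V) ⊆ convexHull ℝ (T : Set V) ∧ IsMedian f D v := by
  classical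
  have hTL : (T : Set V) ⊆ L.vertices :=
    (SimplicialComplex.coe_subset_vertices hT.1).trans (vertices_subset h2 hK hLK)
  obtain ⟨c, hc⟩ := exists_isBarycentric_triangle h2 hT
  obtain ⟨a, b, d, rfl, hab, hbd⟩ := exists_sorted_triple hT.2 (hf.mono hTL)
  have hab0 : a ≠ b := by rintro rfl; exact lt_irrefl _ hab
  have hbd0 : b ≠ d := by rintro rfl; exact lt_irrefl _ hbd
  have had0 : a ≠ d := by rintro rfl; exact lt_asymm hab hbd
  have ca := hc.ne a (by simp) b (by simp) hab0
  have cb := hc.self b (by simp)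
  have cd := hc.ne d (by simp) b (by simp) hbd0.symm
  -- With `σ = -1` the slopes at `a` and `d` are `f d - f b` and `f b - f a`, both positive.
  obtain ⟨w, hfw, hw⟩ := hc.exists_inward (v := b) hab0 had0 hbd0 f (σ := -1)
    (Or.inr ⟨ca, by linarith⟩) (Or.inl (by rw [cb]; norm_num)) (Or.inr ⟨cd, by linarith⟩)
  obtain ⟨D, hD, h⟩ := exists_triangle_median h2 hK hLK hf hT hc (hTL (by simp)) hfw
    ⟨a, by simp, ca⟩ hw
  exact ⟨D, hD, b, by simp, h⟩

/-- The two barycentric coordinates of a point in the relative interior of a side. -/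
theorem IsBarycentric.pos_of_mem_side [DecidableEq V] {a b d v : V} {c : V → V →ᵃ[ℝ] ℝ}
    (hc : IsBarycentric ({a, b, d} : Finset V) c) (hab : a ≠ b)
    (hd : c d v = 0) (hv : v ∈ convexHull ℝ ((({a, b, d} : Finset V) : Set V))) (hvb : v ≠ b) :
    0 < c a v := by
  have hnn := hc.mem_convexHull_iff.1 hv
  refine lt_of_le_of_ne (hnn a (by simp)) fun h0 => hvb ?_
  have := hc.mem_convexHull_of_subset (U := {b}) (by simp) hnn (by
    intro x hx hxb
    simp only [Finset.mem_insert, Finset.mem_singleton] at hx hxb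
    rcases hx with rfl | rfl | rfl
    · exact h0.symm
    · exact (hxb rfl).elim
    · exact hd)
  simpa using this

/-- As `f` is not constant on the side, its level lines are transversal to it, and one of the two
directions points inwards. -/
theorem exists_triangle_median_side (h2 : Module.finrank ℝ V = 2) (hK : IsTriangulatedModel K)
    (hLK : IsSubdivision L K) {f : V →ₗ[ℝ] ℝ} (hf : Set.InjOn f L.vertices) {T e : Finset V}
    (hT : T ∈ triangles K) (heT : e ⊆ T) (he : e.card = 2) {v : V} (hv : v ∈ L.vertices)
    (hve : v ∈ convexHull ℝ (e : Set V)) (hne : v ∉ e) : ∃ D ∈ triangles L,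
      convexHull ℝ (D : Set V) ⊆ convexHull ℝ (T : Set V) ∧ IsMedian f D v := by
  classical
  have hTL : (T : Set V) ⊆ L.vertices :=
    (SimplicialComplex.coe_subset_vertices hT.1).trans (vertices_subset h2 hK hLK)
  obtain ⟨c, hc⟩ := exists_isBarycentric_triangle h2 hT
  obtain ⟨a, b, hab, rfl⟩ := Finset.card_eq_two.1 he
  obtain ⟨d, hdT, hd⟩ := Finset.exists_mem_notMem_of_card_lt_card (s := {a, b}) (t := T)
    (by rw [he, hT.2]; norm_num)
  have hda : d ≠ a := by rintro rfl; simp at hd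
  have hdb : d ≠ b := by rintro rfl; simp at hd
  have hTe : T = {a, b, d} := by
    symm
    refine Finset.eq_of_subset_of_card_le ?_ ?_
    · intro x hx
      simp only [Finset.mem_insert, Finset.mem_singleton] at hx
      rcases hx with rfl | rfl | rfl
      · exact heT (by simp)
      · exact heT (by simp)
      · exact hdT
    · rw [hT.2, Finset.card_eq_three.2 ⟨a, b, d, hab, hda.symm, hdb.symm, rfl⟩]
  subst hTe
  have cd : c d v = 0 := hc.eq_zero_of_mem_convexHull heT hdT hd hve
  have hvT := convexHull_mono (𝕜 := ℝ) (Finset.coe_subset.2 heT) hve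
  have ca := hc.pos_of_mem_side hab cd hvT (by rintro rfl; simp at hne)
  have hperm : ({b, a, d} : Finset V) = {a, b, d} := Finset.insert_comm _ _ _
  have cb := IsBarycentric.pos_of_mem_side (a := b) (b := a) (d := d) (by rwa [hperm]) hab.symm cd
    (by rwa [hperm]) (by rintro rfl; simp at hne)
  have hfab : f a ≠ f b := fun h => hab (hf (hTL (by simp)) (hTL (by simp)) h)
  -- This `σ` makes the slope at the opposite vertex `d` the square `(f a - f b) ^ 2`.
  obtain ⟨w, hfw, hw⟩ := hc.exists_inward (v := v) hab hda.symm hdb.symm f (σ := f a - f b)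
    (Or.inl ca) (Or.inl cb)
    (Or.inr ⟨cd, mul_self_pos.2 (sub_ne_zero.2 hfab)⟩)
  exact exists_triangle_median h2 hK hLK hf hT hc hv hfw ⟨d, by simp, cd⟩ hw

/-- Inside a triangle `T`, only one triangle of a complex contains a given side of `T`. -/
theorem eq_of_side_subset (h2 : Module.finrank ℝ V = 2) {T e D D' : Finset V}
    (hT : T ∈ triangles K) (heT : e ⊆ T) (he : e.card = 2) (hD : D ∈ triangles L)
    (hD' : D' ∈ triangles L) (hDT : convexHull ℝ (D : Set V) ⊆ convexHull ℝ (T : Set V))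
    (hDT' : convexHull ℝ (D' : Set V) ⊆ convexHull ℝ (T : Set V)) (heD : e ⊆ D) (heD' : e ⊆ D') :
    D = D' := by
  classical
  by_contra hne
  obtain ⟨c, hc⟩ := exists_isBarycentric_triangle h2 hT
  obtain ⟨b, hb⟩ := exists_isBarycentric_triangle h2 hD
  obtain ⟨b', hb'⟩ := exists_isBarycentric_triangle h2 hD'
  obtain ⟨d, hdT, hd⟩ := Finset.exists_mem_notMem_of_card_lt_card (s := e) (t := T)
    (by rw [he, hT.2]; norm_num)
  -- the third vertex has a positive coordinate with respect to the third vertex of `T`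
  have third : ∀ Δ ∈ triangles L, convexHull ℝ (Δ : Set V) ⊆ convexHull ℝ (T : Set V) → e ⊆ Δ →
      ∃ x ∈ Δ, x ∉ e ∧ Δ = insert x e ∧ 0 < c d x := by
    intro Δ hΔ hΔT heΔ
    obtain ⟨x, hx, hxe⟩ := Finset.exists_mem_notMem_of_card_lt_card (s := e) (t := Δ)
      (by rw [he, hΔ.2]; norm_num)
    have hins : Δ = insert x e := by
      symm
      refine Finset.eq_of_subset_of_card_le (Finset.insert_subset hx heΔ) ?_
      rw [Finset.card_insert_of_notMem hxe, he, hΔ.2]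
    have hxT := hΔT (subset_convexHull ℝ _ hx)
    have hnn := hc.mem_convexHull_iff.1 hxT
    refine ⟨x, hx, hxe, hins, lt_of_le_of_ne (hnn d hdT) fun h0 => ?_⟩
    have hxe' : x ∈ convexHull ℝ (e : Set V) := by
      refine hc.mem_convexHull_of_subset heT hnn fun a ha hae => ?_
      have : a = d := by
        by_contra had
        have h4 : insert a (insert d e) ⊆ T :=
          Finset.insert_subset ha (Finset.insert_subset hdT heT)
        have := Finset.card_le_card h4
        rw [Finset.card_insert_of_notMem (by simp [had, hae]), Finset.card_insert_of_notMem hd,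
          he, hT.2] at this
        omega
      rw [this, ← h0]
    have hsub : convexHull ℝ (Δ : Set V) ⊆ convexHull ℝ (e : Set V) := by
      refine convexHull_min ?_ (convex_convexHull ℝ _)
      rw [hins, Finset.coe_insert]
      exact Set.insert_subset hxe' (subset_convexHull ℝ _)
    have := card_le_of_convexHull_subset (L.indep hΔ.1) hsub
    rw [he, hΔ.2] at this
    omega
  obtain ⟨x, hxD, hxe, hDe, hcx⟩ := third D hD hDT heD
  obtain ⟨x', hxD', hxe', hDe', hcx'⟩ := third D' hD' hDT' heD'
  obtain ⟨p, q, hpq, rfl⟩ := Finset.card_eq_two.1 he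
  have hpT : p ∈ T := heT (by simp)
  have hqT : q ∈ T := heT (by simp)
  have hpd : d ≠ p := by rintro rfl; simp at hd
  have hqd : d ≠ q := by rintro rfl; simp at hd
  -- the coordinate at `x'` is proportional to the one at `d`
  have hprop : ∀ y, b' x' y = (c d x')⁻¹ * c d y := by
    intro y
    have := hb'.ext_map (f := b' x') (g := (c d x')⁻¹ • c d) (fun a ha => ?_) y
    · simpa using this
    · rw [hDe'] at ha
      have hxp : x' ≠ p := by rintro rfl; simp at hxe'
      have hxq : x' ≠ q := by rintro rfl; simp at hxe'
      simp only [Finset.mem_insert, Finset.mem_singleton] at ha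
      rcases ha with rfl | rfl | rfl
      · rw [hb'.self _ hxD']
        simp [hcx'.ne']
      · rw [hb'.ne _ hxD' _ (heD' (by simp)) hxp]
        simp [hc.ne d hdT _ hpT hpd]
      · rw [hb'.ne _ hxD' _ (heD' (by simp)) hxq]
        simp [hc.ne d hdT _ hqT hqd]
  -- Starting from the midpoint `m` of the side towards `x`, one stays in `D` and also enters the
  -- interior of `D'`: only the coordinate of `x'` vanishes at `m`, and `hprop` makes its slope
  -- positive. This contradicts that `D ∩ D'` is the side.
  set m : V := (1 / 2 : ℝ) • p + (1 / 2 : ℝ) • q with hm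
  have hmid : ∀ g : V →ᵃ[ℝ] ℝ, g m = (g p + g q) / 2 := by
    intro g
    have hk : ∀ y, g y = g.linear y + g 0 := fun y => by simpa using g.map_vadd 0 y
    rw [hk m, hk p, hk q, hm]
    simp only [map_add, map_smul, smul_eq_mul]
    ring
  have hpos : ∀ a ∈ D', ∀ᶠ ε in 𝓝[>] (0 : ℝ), 0 < b' a (m + ε • (x - m)) := by
    intro a ha
    apply IsBarycentric.eventually_pos
    rw [hmid]
    have hpD := heD' (show p ∈ ({p, q} : Finset V) by simp)
    have hqD := heD' (show q ∈ ({p, q} : Finset V) by simp)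
    by_cases hap : a = p
    · subst hap
      left
      rw [hb'.self a ha, hb'.ne a ha q hqD hpq]
      norm_num
    by_cases haq : a = q
    · subst haq
      left
      rw [hb'.self a ha, hb'.ne a ha p hpD hpq.symm]
      norm_num
    have hax : a = x' := by
      rw [hDe'] at ha
      simp only [Finset.mem_insert, Finset.mem_singleton, hap, haq, or_false] at ha
      exact ha
    subst hax
    right
    refine ⟨by rw [hb'.ne a ha p hpD hap, hb'.ne a ha q hqD haq]; norm_num, ?_⟩
    have h1 : b' a x = b' a m + (b' a).linear (x - m) := by
      simpa using IsBarycentric.apply_add_smul (b' a) m (x - m) 1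
    rw [hmid, hb'.ne a ha p hpD hap, hb'.ne a ha q hqD haq, hprop] at h1
    have : 0 < (c d a)⁻¹ * c d x := by positivity
    linarith
  have hlt1 : ∀ᶠ ε in 𝓝[>] (0 : ℝ), ε < 1 :=
    nhdsWithin_le_nhds (gt_mem_nhds zero_lt_one)
  obtain ⟨ε, hall, hε1, hε0⟩ := (((Finset.eventually_all D').2 hpos).and
    (hlt1.and self_mem_nhdsWithin)).exists
  have hε0 : 0 < ε := hε0
  set y := m + ε • (x - m) with hy
  have hyD' : y ∈ convexHull ℝ (D' : Set V) := hb'.mem_convexHull_iff.2 fun a ha => (hall a ha).le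
  have hmD : m ∈ convexHull ℝ (D : Set V) := by
    refine (convex_convexHull ℝ _) (subset_convexHull ℝ _ (heD (by simp)))
      (subset_convexHull ℝ _ (heD (by simp))) ?_ ?_ ?_ <;> norm_num
  have hyD : y ∈ convexHull ℝ (D : Set V) := by
    have := (convex_convexHull ℝ (D : Set V)) hmD (subset_convexHull ℝ _ hxD)
      (sub_nonneg.2 hε1.le) hε0.le (by ring)
    convert this using 1
    rw [hy]
    module
  have hyi := L.inter_subset_convexHull hD.1 hD'.1 ⟨hyD, hyD'⟩
  rw [coe_inter_eq_of_subset hD.2 hD'.2 hne he heD heD'] at hyi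
  have h0 := hb'.eq_zero_of_mem_convexHull heD' hxD' hxe' hyi
  have := hall x' hxD'
  linarith

end Planar

/-! ### Hamiltonian paths crossing bridges -/

/-- If a Hamiltonian path is projected onto a graph, then a bridge of this graph that does not
separate the projected ends is crossed at least twice. -/
theorem exists_two_crossings {X Y : Type*} [DecidableEq X] {H : SimpleGraph X} {G : SimpleGraph Y}
    {π : X → Y} (hsurj : Function.Surjective π)
    (hπ : ∀ x x', H.Adj x x' → π x = π x' ∨ G.Adj (π x) (π x')) {s t : X} {p : H.Walk s t}
    (hp : p.IsHamiltonian) {e : Sym2 Y} (he : G.IsBridge e) (w : G.Walk (π s) (π t))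
    (hw : e ∉ w.edges) :
    ∃ x y x' y', H.Adj x y ∧ H.Adj x' y' ∧ s(π x, π y) = e ∧ s(π x', π y') = e ∧ π x = π x' ∧
      x ≠ x' := by
  set G' := G.deleteEdges {e} with hG'
  -- The nodes over the component of `π s` once `e` is deleted. The walk `w` avoids `e`, so `t`
  -- belongs to it, while some node `x₀` over an end of `e` does not.
  set S : Set X := {x | G'.Reachable (π s) (π x)} with hS
  have hs : s ∈ S := SimpleGraph.Reachable.refl _
  have ht : t ∈ S := ⟨w.toDeleteEdge e hw⟩
  obtain ⟨b, hbe, hb⟩ : ∃ b ∈ e, ¬ G'.Reachable (π s) b := by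
    induction e with
    | h a b =>
      by_contra! hcon
      exact (SimpleGraph.isBridge_iff.1 he) ((hcon a (by simp)).symm.trans (hcon b (by simp)))
  obtain ⟨x₀, rfl⟩ := hsurj b
  have hx₀ : x₀ ∈ p.support := hp.mem_support x₀
  have hx₀S : x₀ ∉ S := hb
  have key : ∀ x y, H.Adj x y → x ∈ S → y ∉ S → s(π x, π y) = e := by
    intro x y hxy hx hy
    have hne : π x ≠ π y := fun h => hy (by
      rw [hS, Set.mem_ofPred_eq, ← h]
      exact hx)
    have hadj := (hπ x y hxy).resolve_left hne
    by_contra hcon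
    have : G'.Adj (π x) (π y) := by
      rw [hG', SimpleGraph.deleteEdges_adj]
      exact ⟨hadj, by simpa using hcon⟩
    exact hy (SimpleGraph.Reachable.trans hx this.reachable)
  obtain ⟨d₁, hd₁, h1, h1'⟩ := (p.takeUntil x₀ hx₀).exists_boundary_dart S hs hx₀S
  obtain ⟨d₂, hd₂, h2, h2'⟩ := (p.dropUntil x₀ hx₀).exists_boundary_dart Sᶜ hx₀S
    (by simpa using ht)
  have h2' : d₂.snd ∈ S := by simpa using h2'
  have e1 := key _ _ d₁.adj h1 h1'
  have e2 := key _ _ d₂.adj.symm h2' h2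
  -- The path leaves `S` before `x₀` and returns after it; being a path, it does not reuse a node.
  have hne : d₁.fst ≠ d₂.snd := by
    have hnd := hp.isPath.support_nodup
    rw [← p.take_spec hx₀, SimpleGraph.Walk.support_append, List.nodup_append] at hnd
    refine hnd.2.2 _ ((p.takeUntil x₀ hx₀).dart_fst_mem_support_of_mem_darts hd₁) _ ?_
    rw [← SimpleGraph.Walk.map_snd_darts]
    exact List.mem_map_of_mem hd₂
  refine ⟨d₁.fst, d₁.snd, d₂.snd, d₂.fst, d₁.adj, d₂.adj.symm, e1, e2, ?_, hne⟩
  rcases Sym2.eq_iff.1 (e1.trans e2.symm) with h | h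
  · exact h.1
  · exact (h2 (by rw [hS, Set.mem_ofPred_eq, ← h.1]; exact h1)).elim

/-! ### Counting the triangles of a strip -/

section LowerBound

variable {V : Type*} [NormedAddCommGroup V] [NormedSpace ℝ V] {K L : SimplicialComplex ℝ V}

theorem exists_side_of_adj {T T' : triangles K} (h : (dualGraph K).Adj T T') :
    ∃ e ∈ K.faces, e.card = 2 ∧ e ⊆ T.1 ∧ e ⊆ T'.1 ∧ (T.1 ∩ T'.1 : Set V) = e := by
  obtain ⟨hne, e, he, h2, h3, h4⟩ := h
  exact ⟨e, he, h2, h3, h4, coe_inter_eq_of_subset T.2.2 T'.2.2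
    (fun h => hne (Subtype.ext h)) h2 h3 h4⟩

/-- The edge crossed by a dart of the dual graph of `K` is subdivided in `L`. -/
def IsSplit (L : SimplicialComplex ℝ V) (d : (dualGraph K).Dart) : Prop :=
  ∃ v ∈ L.vertices, v ∈ convexHull ℝ (d.fst.1 ∩ d.snd.1 : Set V) ∧ v ∉ (d.fst.1 ∩ d.snd.1 : Set V)

/-- There are at least as many triangles in a subdivision as there are triangles and split
darts of the dual tree. -/
theorem card_add_card_split_le (h2 : Module.finrank ℝ V = 2) (hK : IsTriangulatedModel K)
    (hLK : IsSubdivision L K) (hac : (dualGraph K).IsAcyclic) {f : V →ₗ[ℝ] ℝ}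
    (hf : Set.InjOn f L.vertices) [Finite (triangles L)] :
    Nat.card (triangles K ⊕ {d : (dualGraph K).Dart // IsSplit L d}) ≤ Nat.card (triangles L) := by
  classical
  choose D₁ hD₁ v₁ hv₁ hDT₁ hm₁ using fun T : triangles K =>
    exists_triangle_median_vertex h2 hK hLK hf T.2
  choose v₂ hv₂ hve₂ hne₂ using fun d : {d : (dualGraph K).Dart // IsSplit L d} => d.2
  have hside : ∀ d : {d : (dualGraph K).Dart // IsSplit L d}, ∃ D ∈ triangles L,
      convexHull ℝ (D : Set V) ⊆ convexHull ℝ (d.1.fst.1 : Set V) ∧ IsMedian f D (v₂ d) := by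
    intro d
    obtain ⟨e, -, he, h3, -, h5⟩ := exists_side_of_adj d.1.adj
    have h6 := hve₂ d
    have h7 := hne₂ d
    rw [h5] at h6 h7
    exact exists_triangle_median_side h2 hK hLK hf d.1.fst.2 h3 he (hv₂ d) h6 (by simpa using h7)
  choose D₂ hD₂ hDT₂ hm₂ using hside
  refine Nat.card_le_card_of_injective
    (Sum.elim (fun T => (⟨D₁ T, hD₁ T⟩ : triangles L)) fun d => ⟨D₂ d, hD₂ d⟩) ?_
  -- A splitting point is never a vertex of its triangle, which keeps the two kinds of medians
  -- apart.
  have hv₂K : ∀ d, v₂ d ∉ (d.1.fst.1 : Set V) := by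
    intro d hd
    have hdK := SimplicialComplex.coe_subset_vertices d.1.fst.2.1 hd
    obtain ⟨e, he, -, -, -, h5⟩ := exists_side_of_adj d.1.adj
    have h6 := hve₂ d
    have h7 := hne₂ d
    rw [h5] at h6 h7
    exact h7 ((SimplicialComplex.vertex_mem_convexHull_iff hdK he).1 h6)
  rintro (T | d) (T' | d') h
  · simp only [Sum.elim_inl, Subtype.mk.injEq] at h
    congr 1
    exact Subtype.ext (eq_of_convexHull_subset T.2 T'.2 (hD₁ T) (hDT₁ T) (h ▸ hDT₁ T'))
  · simp only [Sum.elim_inl, Sum.elim_inr, Subtype.mk.injEq] at h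
    have hT : T = d'.1.fst :=
      Subtype.ext (eq_of_convexHull_subset T.2 d'.1.fst.2 (hD₁ T) (hDT₁ T) (h ▸ hDT₂ d'))
    have hv := (hm₁ T).unique (hD₁ T).2 (h ▸ hm₂ d')
    exact (hv₂K d' (by rw [← hT, ← hv]; exact hv₁ T)).elim
  · simp only [Sum.elim_inl, Sum.elim_inr, Subtype.mk.injEq] at h
    have hT : T' = d.1.fst :=
      Subtype.ext (eq_of_convexHull_subset T'.2 d.1.fst.2 (hD₁ T') (hDT₁ T') (h ▸ hDT₂ d))
    have hv := (hm₁ T').unique (hD₁ T').2 (h ▸ hm₂ d)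
    exact (hv₂K d (by rw [← hT, ← hv]; exact hv₁ T')).elim
  · simp only [Sum.elim_inr, Subtype.mk.injEq] at h
    congr 1
    have hT : d.1.fst = d'.1.fst :=
      Subtype.ext (eq_of_convexHull_subset d.1.fst.2 d'.1.fst.2 (hD₂ d) (hDT₂ d) (h ▸ hDT₂ d'))
    have hv : v₂ d = v₂ d' := (hm₂ d).unique (hD₂ d).2 (h ▸ hm₂ d')
    obtain ⟨⟨⟨T, T₁⟩, hadj⟩, hd⟩ := d
    obtain ⟨⟨⟨T', T₂⟩, hadj'⟩, hd'⟩ := d'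
    simp only at hT
    subst hT
    suffices T₁ = T₂ by subst this; rfl
    obtain ⟨e, heK, he, heT, heT₁, hi⟩ := exists_side_of_adj hadj
    obtain ⟨e', heK', he', heT', heT₂, hi'⟩ := exists_side_of_adj hadj'
    have h6 := hve₂ ⟨⟨⟨T, T₁⟩, hadj⟩, hd⟩
    have h7 := hne₂ ⟨⟨⟨T, T₁⟩, hadj⟩, hd⟩
    have h6' := hve₂ ⟨⟨⟨T, T₂⟩, hadj'⟩, hd'⟩
    rw [← hv] at h6'
    simp only [hi] at h6 h7
    simp only [hi'] at h6'
    generalize v₂ _ = v at h6 h7 h6'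
    -- Two different sides of `T` share at most one vertex, and `v` is not a vertex of `e`.
    have hee : e = e' := by
      by_contra hne
      have hm := K.inter_subset_convexHull heK heK' ⟨h6, h6'⟩
      rw [← Finset.coe_inter] at hm
      have hcard : (e ∩ e').card ≤ 1 := by
        by_contra! hlt
        have h8 : e ∩ e' = e :=
          Finset.eq_of_subset_of_card_le Finset.inter_subset_left (by omega)
        have h9 : e ∩ e' = e' :=
          Finset.eq_of_subset_of_card_le Finset.inter_subset_right (by omega)
        exact hne (h8.symm.trans h9)
      rcases Finset.card_le_one_iff_subset_singleton (s := e ∩ e').1 hcard with ⟨u, hu⟩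
      have hvu := convexHull_mono (𝕜 := ℝ) (Finset.coe_subset.2 hu) hm
      simp only [Finset.coe_singleton, convexHull_singleton, Set.mem_singleton_iff] at hvu
      rcases Finset.subset_singleton_iff.1 hu with h0 | h0
      · simp [h0] at hm
      · have : u ∈ e ∩ e' := by simp [h0]
        exact h7 (hvu ▸ (Finset.mem_inter.1 this).1)
    subst hee
    -- Otherwise `T`, `T₁`, `T₂` share the side `e` and form a cycle, so the edge from `T` to `T₁`
    -- is not a bridge.
    by_contra hne
    have h12 : (dualGraph K).Adj T₁ T₂ := ⟨hne, e, heK, he, heT₁, heT₂⟩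
    have hbr := SimpleGraph.isAcyclic_iff_forall_adj_isBridge.1 hac hadj
    rw [SimpleGraph.isBridge_iff] at hbr
    have a1 : ((dualGraph K).deleteEdges {s(T, T₁)}).Adj T T₂ := by
      rw [SimpleGraph.deleteEdges_adj]
      refine ⟨hadj', ?_⟩
      simp only [Set.mem_singleton_iff, Sym2.eq_iff]
      rintro (h | h)
      · exact hne h.2.symm
      · exact hadj.ne h.1
    have a2 : ((dualGraph K).deleteEdges {s(T, T₁)}).Adj T₂ T₁ := by
      rw [SimpleGraph.deleteEdges_adj]
      refine ⟨h12.symm, ?_⟩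
      simp only [Set.mem_singleton_iff, Sym2.eq_iff]
      rintro (h | h)
      · exact hadj'.ne h.1.symm
      · exact hne h.1.symm
    exact hbr (a1.reachable.trans a2.reachable)

/-- The sides that are not subdivided are those crossed by the tree path between the triangles that
contain the ends of the strip. -/
theorem isSplit_or_mem_edges (h2 : Module.finrank ℝ V = 2)
    (hac : (dualGraph K).IsAcyclic) {π : triangles L → triangles K}
    (hsurj : Function.Surjective π)
    (hπ : ∀ D, convexHull ℝ (D.1 : Set V) ⊆ convexHull ℝ ((π D).1 : Set V))
    {s t : triangles L} {p : (dualGraph L).Walk s t} (hp : IsSingleStrip L p)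
    (w : (dualGraph K).Walk (π s) (π t)) (d : (dualGraph K).Dart) :
    IsSplit L d ∨ d.edge ∈ w.edges := by
  classical
  by_contra! hcon
  obtain ⟨hns, hw⟩ := hcon
  have hedge : ∀ x y : triangles L, (dualGraph L).Adj x y → ∃ e ∈ L.faces, e.card = 2 ∧ e ⊆ x.1 ∧
      convexHull ℝ (e : Set V) ⊆ convexHull ℝ ((π x).1 ∩ (π y).1 : Set V) := by
    rintro x y ⟨-, e, he, hc, hx, hy⟩
    exact ⟨e, he, hc, hx, (Set.subset_inter
      ((convexHull_mono (Finset.coe_subset.2 hx)).trans (hπ x))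
      ((convexHull_mono (Finset.coe_subset.2 hy)).trans (hπ y))).trans
      (K.inter_subset_convexHull (π x).2.1 (π y).2.1)⟩
  -- A common edge of `x` and `y` lies in the hull of the common vertices of their owners; by
  -- dimension there are at least two of these.
  have hadj : ∀ x y : triangles L, (dualGraph L).Adj x y →
      π x = π y ∨ (dualGraph K).Adj (π x) (π y) := by
    intro x y hxy
    by_cases hne : π x = π y
    · exact Or.inl hne
    right
    obtain ⟨e, he, hc, -, hsub⟩ := hedge x y hxy
    rw [← Finset.coe_inter] at hsub
    have hcard := card_le_of_convexHull_subset (L.indep he) hsub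
    obtain ⟨g, hg, hg2⟩ := Finset.exists_subset_card_eq (hc ▸ hcard)
    refine ⟨hne, g, K.down_closed (π x).2.1 (hg.trans Finset.inter_subset_left) ?_, hg2,
      hg.trans Finset.inter_subset_left, hg.trans Finset.inter_subset_right⟩
    exact Finset.card_pos.1 (by omega)
  have hbr : (dualGraph K).IsBridge d.edge :=
    SimpleGraph.isAcyclic_iff_forall_adj_isBridge.1 hac d.adj
  obtain ⟨x, y, x', y', hxy, hxy', h1, h1', hxx, hne⟩ :=
    exists_two_crossings hsurj hadj hp hbr w hw
  obtain ⟨e, -, he, heT, heT', hi⟩ := exists_side_of_adj d.adj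
  have hcoe : ∀ x y : triangles L, s(π x, π y) = d.edge →
      ((π x).1 ∩ (π y).1 : Set V) = e := by
    intro x y h
    rw [← hi]
    rcases Sym2.eq_iff.1 h with ⟨h, h'⟩ | ⟨h, h'⟩
    · rw [h, h']
    · rw [h, h', Set.inter_comm]
  -- The crossing edge `g` lies in the side `e`, which carries no vertices of `L` but its ends;
  -- hence `g = e`.
  have hside : ∀ x y : triangles L, (dualGraph L).Adj x y → s(π x, π y) = d.edge → e ⊆ x.1 := by
    intro x y hxy h
    obtain ⟨g, hgL, hg, hgx, hsub⟩ := hedge x y hxy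
    rw [hcoe x y h] at hsub
    have hge : g ⊆ e := by
      intro u hu
      by_contra hue
      refine hns ⟨u, SimplicialComplex.coe_subset_vertices hgL hu, ?_, ?_⟩
      · rw [hi]
        exact hsub (subset_convexHull ℝ _ hu)
      · rw [hi]
        simpa using hue
    rw [← Finset.eq_of_subset_of_card_le hge (by omega)]
    exact hgx
  have hex : e ⊆ (π x).1 := by
    have := hcoe x y h1
    rw [← Finset.coe_inter, Finset.coe_inj] at this
    rw [← this]
    exact Finset.inter_subset_left
  exact hne (Subtype.ext (eq_of_side_subset h2 (π x).2 hex he x.2 x'.2 (hπ x) (hxx ▸ hπ x')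
    (hside x y hxy h1) (hside x' y' hxy' h1')))

/-- A lower bound for single strips through subdivisions of models with a dual tree. -/
theorem strip_length_ge (h2 : Module.finrank ℝ V = 2) (hK : IsTriangulatedModel K)
    (hLK : IsSubdivision L K) {k : ℕ} (htree : IsCompleteCubicTree (dualGraph K) k)
    {f : V →ₗ[ℝ] ℝ} (hf : Set.InjOn f L.vertices)
    {s t : triangles L} {p : (dualGraph L).Walk s t} (hp : IsSingleStrip L p) :
    3 * numTriangles K ≤ p.support.length + 4 * k + 2 := by
  classical
  obtain ⟨htr, r, hr⟩ := htree
  have hfinK : Finite (triangles K) := (hK.1.subset fun t ht => ht.1).to_subtype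
  have hfinL : Finite (triangles L) := (hLK.1.subset fun t ht => ht.1).to_subtype
  have := Fintype.ofFinite (triangles K)
  have := Fintype.ofFinite (triangles L)
  have howner : ∀ D : triangles L, ∃ T : triangles K,
      convexHull ℝ (D.1 : Set V) ⊆ convexHull ℝ (T.1 : Set V) := fun D => by
    obtain ⟨T, hT, h⟩ := exists_owner hK hLK D.2.1
    exact ⟨⟨T, hT⟩, h⟩
  choose π hπ using howner
  have hsurj : Function.Surjective π := by
    intro T
    obtain ⟨D, hD, v, hv, hDT, -⟩ := exists_triangle_median_vertex h2 hK hLK hf T.2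
    exact ⟨⟨D, hD⟩, Subtype.ext (eq_of_convexHull_subset (π ⟨D, hD⟩).2 T.2 hD (hπ ⟨D, hD⟩) hDT)⟩
  obtain ⟨w₁, hw₁⟩ := htr.connected.exists_walk_length_eq_dist r (π s)
  obtain ⟨w₂, hw₂⟩ := htr.connected.exists_walk_length_eq_dist r (π t)
  -- Going through the root gives length at most `2 * k`.
  set w := w₁.reverse.append w₂ with hw
  have hlen : w.length ≤ 2 * k := by
    rw [hw, SimpleGraph.Walk.length_append, SimpleGraph.Walk.length_reverse, hw₁, hw₂]
    have := (hr (π s)).1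
    have := (hr (π t)).1
    omega
  have hcount := card_add_card_split_le h2 hK hLK htr.isAcyclic hf
  rw [Nat.card_sum, Nat.card_eq_fintype_card (α := triangles L), ← hp.length_support,
    Nat.card_eq_fintype_card (α := {d // IsSplit L d}), Fintype.card_subtype] at hcount
  have hnum : numTriangles K = Nat.card (triangles K) := rfl
  rw [← hnum] at hcount
  have hdarts : (dualGraph K).edgeFinset.card + 1 = numTriangles K := by
    rw [htr.card_edgeFinset, hnum, Nat.card_eq_fintype_card]
  have hdarts2 := (dualGraph K).dart_card_eq_twice_card_edges
  -- Each edge of `w` accounts for two darts.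
  have hsplit : (Finset.univ.filter fun d : (dualGraph K).Dart => ¬ IsSplit L d).card ≤ 4 * k := by
    have hsub : (Finset.univ.filter fun d : (dualGraph K).Dart => ¬ IsSplit L d) ⊆
        w.darts.toFinset ∪ w.darts.toFinset.image SimpleGraph.Dart.symm := by
      intro d hd
      have hd := (Finset.mem_filter.1 hd).2
      have hm := (isSplit_or_mem_edges h2 htr.isAcyclic hsurj hπ hp w d).resolve_left hd
      obtain ⟨d', hd', he⟩ := List.mem_map.1 hm
      rw [Finset.mem_union, List.mem_toFinset, Finset.mem_image]
      rcases (SimpleGraph.dart_edge_eq_iff d d').1 he.symm with rfl | rfl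
      · exact Or.inl hd'
      · exact Or.inr ⟨d', by simpa using hd', rfl⟩
    have h1 := Finset.card_le_card hsub
    have h3 := Finset.card_union_le w.darts.toFinset (w.darts.toFinset.image SimpleGraph.Dart.symm)
    have h4 : (w.darts.toFinset.image SimpleGraph.Dart.symm).card ≤ w.darts.toFinset.card :=
      Finset.card_image_le
    have h5 := w.darts.toFinset_card_le
    rw [SimpleGraph.Walk.length_darts] at h5
    omega
  have htot := Finset.card_filter_add_card_filter_not (s := Finset.univ)
    (fun d : (dualGraph K).Dart => IsSplit L d)
  rw [Finset.card_univ] at htot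
  omega

end LowerBound

/-- A linear functional on the plane that separates the points of a finite set. -/
theorem exists_injOn_linear {S : Set (EuclideanSpace ℝ (Fin 2))} (hS : S.Finite) :
    ∃ f : EuclideanSpace ℝ (Fin 2) →ₗ[ℝ] ℝ, Set.InjOn f S := by
  -- The functional `x 0 + m * x 1` can identify two points with different second coordinates only
  -- if `m` is one of these finitely many quotients. Pairs with equal second coordinates contribute
  -- only a harmless extra value.
  have hbad : ((fun q : EuclideanSpace ℝ (Fin 2) × EuclideanSpace ℝ (Fin 2) =>
      -(q.1 0 - q.2 0) / (q.1 1 - q.2 1)) '' S ×ˢ S).Finite := (hS.prod hS).image _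
  obtain ⟨m, hm⟩ := hbad.exists_notMem
  refine ⟨(EuclideanSpace.proj 0 : EuclideanSpace ℝ (Fin 2) →L[ℝ] ℝ).toLinearMap +
    m • (EuclideanSpace.proj 1 : EuclideanSpace ℝ (Fin 2) →L[ℝ] ℝ).toLinearMap, ?_⟩
  intro x hx y hy hxy
  have hxy : x 0 + m * x 1 = y 0 + m * y 1 := hxy
  have h1 : x 1 = y 1 := by
    by_contra hne
    refine hm ⟨(x, y), ⟨hx, hy⟩, ?_⟩
    have : x 1 - y 1 ≠ 0 := sub_ne_zero.2 hne
    simp only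
    field_simp
    linarith
  have h0 : x 0 = y 0 := by rw [h1] at hxy; linarith
  ext i
  fin_cases i
  · exact h0
  · exact h1

/-! ### Convex hulls separated by a line -/

section Separation

variable {V : Type*} [AddCommGroup V] [Module ℝ V]

theorem affineIndependent_pair [DecidableEq V] (a b : V) :
    AffineIndependent ℝ ((↑) : ({a, b} : Finset V) → V) := by
  by_cases h : a = b
  · subst h
    have : Subsingleton ({a, a} : Finset V) := ⟨fun x y => by
      have hx := x.2
      have hy := y.2
      simp only [Finset.mem_insert, Finset.mem_singleton, or_self] at hx hy
      exact Subtype.ext (hx.trans hy.symm)⟩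
    exact affineIndependent_of_subsingleton _ _
  · have h1 := (affineIndependent_of_ne ℝ h).range
    have h3 : ((({a, b} : Finset V)) : Set V) = Set.range ![a, b] := by
      simp [Matrix.range_cons, Matrix.range_empty, Set.pair_comm]
    exact (affineIndependent_equiv (Equiv.setCongr h3)).2 h1

/-- On a line through `a` and `d` the functional `g` would vanish identically. -/
theorem affineIndependent_triple [DecidableEq V] {g : V →ᵃ[ℝ] ℝ} {a b d : V} (hne : a ≠ d)
    (ha : g a = 0) (hd : g d = 0) (hb : g b ≠ 0) :
    AffineIndependent ℝ ((↑) : ({a, b, d} : Finset V) → V) := by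
  have hnc : ¬ Collinear ℝ ({a, b, d} : Set V) := by
    rw [collinear_iff_of_mem (p₀ := a) (by simp)]
    rintro ⟨v, hv⟩
    obtain ⟨r, hr⟩ := hv d (by simp)
    obtain ⟨r', hr'⟩ := hv b (by simp)
    rw [vadd_eq_add, add_comm] at hr hr'
    have h1 := IsBarycentric.apply_add_smul g a v r
    have h2 := IsBarycentric.apply_add_smul g a v r'
    rw [← hr, ha, hd, zero_add] at h1
    rw [← hr', ha, zero_add] at h2
    rcases mul_eq_zero.1 h1.symm with h | h
    · rw [h, zero_smul, add_zero] at hr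
      exact hne hr.symm
    · rw [h, mul_zero] at h2
      exact hb h2
  have h1 := (affineIndependent_iff_not_collinear_set.2 hnc).range
  have h3 : ((({a, b, d} : Finset V)) : Set V) = Set.range ![a, b, d] := by
    ext x
    simp only [Finset.coe_insert, Finset.coe_singleton, Set.mem_insert_iff, Set.mem_singleton_iff,
      Set.mem_range, Fin.exists_fin_succ]
    simp [eq_comm]
  exact (affineIndependent_equiv (Equiv.setCongr h3)).2 h1

/-- A vanishing sum of nonnegative terms leaves no weight where `g` is positive. -/
theorem mem_convexHull_filter {s : Finset V} {g : V →ᵃ[ℝ] ℝ} [DecidablePred fun y => g y = 0]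
    (hs : ∀ y ∈ s, 0 ≤ g y) {x : V} (hx : x ∈ convexHull ℝ (s : Set V)) (hgx : g x = 0) :
    x ∈ convexHull ℝ ((s.filter fun y => g y = 0 : Finset V) : Set V) := by
  obtain ⟨w, hw0, hw1, rfl⟩ := Finset.mem_convexHull'.1 hx
  have hk : ∀ y, g y = g.linear y + g 0 := fun y => by simpa using g.map_vadd 0 y
  have hsum : ∑ y ∈ s, w y * g y = 0 := by
    rw [← hgx, hk, map_sum]
    simp only [map_smul, smul_eq_mul]
    rw [← one_mul (g 0), ← hw1, Finset.sum_mul, ← Finset.sum_add_distrib]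
    exact Finset.sum_congr rfl fun y _ => by rw [hk y]; ring
  rw [Finset.sum_eq_zero_iff_of_nonneg fun y hy => mul_nonneg (hw0 y hy) (hs y hy)] at hsum
  have hz : ∀ y ∈ s, y ∉ s.filter (fun y => g y = 0) → w y = 0 := fun y hy hy' =>
    (mul_eq_zero.1 (hsum y hy)).resolve_right fun h => hy' (Finset.mem_filter.2 ⟨hy, h⟩)
  refine Finset.mem_convexHull'.2 ⟨w, fun y hy => hw0 y (Finset.mem_filter.1 hy).1, ?_, ?_⟩
  · rw [Finset.sum_subset (Finset.filter_subset _ _) hz, hw1]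
  · exact Finset.sum_subset (Finset.filter_subset _ _) fun y hy hy' => by
      rw [hz y hy hy', zero_smul]

/-- Simplices on different sides of a line that contains at most two of the vertices intersect in
a common face. -/
theorem inter_subset_of_separated {s t : Finset V} {g : V →ᵃ[ℝ] ℝ} {a b : V}
    (hs : ∀ y ∈ s, 0 ≤ g y) (ht : ∀ y ∈ t, g y ≤ 0)
    (hs0 : ∀ y ∈ s, g y = 0 → y = a ∨ y = b) (ht0 : ∀ y ∈ t, g y = 0 → y = a ∨ y = b) :
    convexHull ℝ (s : Set V) ∩ convexHull ℝ (t : Set V) ⊆ convexHull ℝ (s ∩ t : Set V) := by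
  classical
  rintro x ⟨hxs, hxt⟩
  have h1 : 0 ≤ g x :=
    convexHull_min (t := {y | 0 ≤ g y}) hs ((convex_Ici (0 : ℝ)).affine_preimage g) hxs
  have h2 : g x ≤ 0 :=
    convexHull_min (t := {y | g y ≤ 0}) ht ((convex_Iic (0 : ℝ)).affine_preimage g) hxt
  have hgx := le_antisymm h2 h1
  have hxs' := mem_convexHull_filter hs hxs hgx
  have hxt' := mem_convexHull_filter (g := -g) (s := t) (by simpa using ht) hxt (by simp [hgx])
  have hsub : ∀ r : Finset V, (∀ y ∈ r, y = a ∨ y = b) → r ⊆ {a, b} := fun r hr y hy => by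
    simpa using hr y hy
  -- A common point lies on the line, hence in the hulls of two subsets of `{a, b}`, which meet in a
  -- common face.
  have := (affineIndependent_pair a b).convexHull_inter
    (hsub (s.filter fun y => g y = 0) fun y hy =>
      hs0 y (Finset.mem_filter.1 hy).1 (Finset.mem_filter.1 hy).2)
    (hsub (t.filter fun y => (-g) y = 0) fun y hy =>
      ht0 y (Finset.mem_filter.1 hy).1 (by simpa using (Finset.mem_filter.1 hy).2))
  refine convexHull_mono ?_ (this.ge ⟨hxs', hxt'⟩)
  intro y hy
  have h1 := Finset.mem_filter.1 (Finset.mem_coe.1 hy.1)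
  have h2 := Finset.mem_filter.1 (Finset.mem_coe.1 hy.2)
  exact ⟨h1.1, h2.1⟩

/-- Adding a point beyond a side `a b` of a convex hull adds only a triangle. -/
theorem convexHull_insert_subset {S : Set V} {g : V →ᵃ[ℝ] ℝ} {a b v : V} (ha : a ∈ S) (hb : b ∈ S)
    (hS : ∀ y ∈ S, g y ≤ 0) (hv : 0 < g v)
    (hchord : ∀ z ∈ convexHull ℝ (insert v S), g z = 0 → z ∈ segment ℝ a b) :
    convexHull ℝ (insert v S) ⊆ convexHull ℝ S ∪ convexHull ℝ {a, v, b} := by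
  intro x hx
  have hx' := hx
  rw [convexHull_insert ⟨a, ha⟩, convexJoin_singleton_left] at hx'
  simp only [Set.mem_iUnion] at hx'
  obtain ⟨y, hy, p, q, hp, hq, hpq, rfl⟩ := hx'
  have hgy : g y ≤ 0 :=
    convexHull_min (t := {y | g y ≤ 0}) hS ((convex_Iic (0 : ℝ)).affine_preimage g) hy
  have hden : 0 < g v - g y := by linarith
  -- The parameter at which the segment from `v` to `y` crosses the line `g = 0`, in the point `z`.
  -- Up to `z` the segment lies in the added triangle, beyond it in the old hull.
  set τ := g v / (g v - g y) with hτ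
  have hτ0 : 0 < τ := div_pos hv hden
  have hτ1 : τ ≤ 1 := (div_le_one hden).2 (by linarith)
  set z := v + τ • (y - v) with hz
  have hlin : g.linear (y - v) = g y - g v := by
    have := IsBarycentric.apply_add_smul g v (y - v) 1
    simp only [one_smul, add_sub_cancel, one_mul] at this
    linarith
  have hgz : g z = 0 := by
    rw [hz, IsBarycentric.apply_add_smul, hlin, hτ]
    field_simp
    ring
  have hzmem : z ∈ convexHull ℝ (insert v S) := by
    have := (convex_convexHull ℝ (insert v S)) (subset_convexHull ℝ _ (Set.mem_insert v S))
      (convexHull_mono (Set.subset_insert v S) hy) (sub_nonneg.2 hτ1) hτ0.le (by ring)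
    convert this using 1
    rw [hz]; module
  have hzseg := hchord z hzmem hgz
  have hzS : z ∈ convexHull ℝ S := segment_subset_convexHull ha hb hzseg
  have hzT : z ∈ convexHull ℝ {a, v, b} := segment_subset_convexHull (by simp) (by simp) hzseg
  obtain rfl : p = 1 - q := by linarith
  by_cases hle : q ≤ τ
  · right
    have := (convex_convexHull ℝ ({a, v, b} : Set V))
      (subset_convexHull ℝ _ (show v ∈ ({a, v, b} : Set V) by simp)) hzT
      (sub_nonneg.2 ((div_le_one hτ0).2 hle)) (div_nonneg hq hτ0.le) (by ring)
    convert this using 1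
    have h1 : (q / τ) • z = (q / τ) • v + q • (y - v) := by
      rw [hz, smul_add, smul_smul, div_mul_cancel₀ _ hτ0.ne']
    rw [h1]; module
  · left
    push Not at hle
    have h1τ : 0 < 1 - τ := by linarith
    have := (convex_convexHull ℝ S) hzS hy (div_nonneg hp h1τ.le)
      (sub_nonneg.2 ((div_le_one h1τ).2 (by linarith : 1 - q ≤ 1 - τ))) (by ring)
    convert this using 1
    have h1 : z = y + (1 - τ) • (v - y) := by rw [hz]; module
    have h2 : ((1 - q) / (1 - τ)) • z = ((1 - q) / (1 - τ)) • y + (1 - q) • (v - y) := by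
      rw [h1, smul_add, smul_smul, div_mul_cancel₀ _ h1τ.ne']
    rw [h2]; module

end Separation

/-! ### The recursive triangulation as a simplicial complex -/

section Polygon

local notation "Plane" => EuclideanSpace ℝ (Fin 2)

theorem polygonVertex_zero_coord (N i : ℕ) :
    polygonVertex N i 0 = Real.cos (2 * Real.pi * i / N) := rfl

theorem polygonVertex_one_coord (N i : ℕ) :
    polygonVertex N i 1 = Real.sin (2 * Real.pi * i / N) := rfl

theorem polygonVertex_double (n i : ℕ) :
    polygonVertex (2 * n) (2 * i) = polygonVertex n i := by
  have h : 2 * Real.pi * ((2 * i : ℕ) : ℝ) / ((2 * n : ℕ) : ℝ) = 2 * Real.pi * i / n := by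
    push_cast
    rw [mul_left_comm]
    exact mul_div_mul_left _ _ two_ne_zero
  rw [polygonVertex, polygonVertex, h]

theorem cos_sub_polygon (N i j : ℕ) :
    polygonVertex N i 0 * polygonVertex N j 0 + polygonVertex N i 1 * polygonVertex N j 1 =
      Real.cos (2 * Real.pi * ((i : ℝ) - j) / N) := by
  simp only [polygonVertex_zero_coord, polygonVertex_one_coord]
  rw [← Real.cos_sub]
  congr 1
  ring

theorem polygonVertex_eq_iff {N : ℕ} (hN : N ≠ 0) (i j : ℕ) :
    polygonVertex N i = polygonVertex N j ↔ i ≡ j [MOD N] := by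
  have hN' : (N : ℝ) ≠ 0 := Nat.cast_ne_zero.2 hN
  have hpi := Real.pi_ne_zero
  constructor
  · intro h
    have h1 := cos_sub_polygon N i j
    rw [h, polygonVertex_zero_coord, polygonVertex_one_coord, ← sq, ← sq, Real.cos_sq_add_sin_sq,
      eq_comm, Real.cos_eq_one_iff] at h1
    obtain ⟨m, hm⟩ := h1
    have h2 : (i : ℝ) - j = m * N := by
      field_simp at hm
      linarith
    have h3 : (i : ℤ) - j = m * N := by exact_mod_cast h2
    rw [← Int.natCast_modEq_iff, Int.modEq_comm, Int.modEq_iff_dvd]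
    exact ⟨m, by rw [h3, mul_comm]⟩
  · intro h
    rw [← Int.natCast_modEq_iff, Int.modEq_comm, Int.modEq_iff_dvd] at h
    obtain ⟨m, hm⟩ := h
    have h2 : (i : ℝ) = j + m * N := by
      have : (i : ℝ) - j = N * m := by exact_mod_cast hm
      linarith
    have h3 : 2 * Real.pi * (i : ℝ) / N = 2 * Real.pi * j / N + m * (2 * Real.pi) := by
      rw [h2]; field_simp
    rw [polygonVertex, polygonVertex, h3, Real.cos_add_int_mul_two_pi, Real.sin_add_int_mul_two_pi]

theorem cos_lt_cos_of_mem {δ θ : ℝ} (hδ : 0 < δ) (h1 : δ < θ) (h2 : θ < 2 * Real.pi - δ) :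
    Real.cos θ < Real.cos δ := by
  have := Real.cos_sub_cos θ δ
  have hs1 : 0 < Real.sin ((θ + δ) / 2) :=
    Real.sin_pos_of_pos_of_lt_pi (by linarith) (by linarith)
  have hs2 : 0 < Real.sin ((θ - δ) / 2) :=
    Real.sin_pos_of_pos_of_lt_pi (by linarith) (by linarith)
  have := mul_pos hs1 hs2
  linarith

/-- The affine functional that vanishes on the neighbours of the `m`-th vertex of the regular
`N`-gon and is positive at this vertex. -/
noncomputable def cutoff (N m : ℕ) : Plane →ᵃ[ℝ] ℝ :=
  (polygonVertex N m 0 • (EuclideanSpace.proj 0 : Plane →L[ℝ] ℝ).toLinearMap +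
    polygonVertex N m 1 • (EuclideanSpace.proj 1 : Plane →L[ℝ] ℝ).toLinearMap).toAffineMap -
    AffineMap.const ℝ _ (Real.cos (2 * Real.pi / N))

theorem cutoff_apply (N m : ℕ) (x : Plane) :
    cutoff N m x = polygonVertex N m 0 * x 0 + polygonVertex N m 1 * x 1 -
      Real.cos (2 * Real.pi / N) := rfl

theorem cutoff_vertex (N m j : ℕ) : cutoff N m (polygonVertex N j) =
    Real.cos (2 * Real.pi * ((m : ℝ) - j) / N) - Real.cos (2 * Real.pi / N) := by
  rw [cutoff_apply, cos_sub_polygon]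

theorem two_pi_div_pos_lt {N : ℕ} (hN : 3 ≤ N) :
    0 < 2 * Real.pi / N ∧ 2 * Real.pi / N < Real.pi := by
  have h3 : (3 : ℝ) ≤ N := by exact_mod_cast hN
  have hpi := Real.pi_pos
  refine ⟨by positivity, ?_⟩
  rw [div_lt_iff₀ (by linarith)]
  nlinarith

theorem cutoff_self_pos {N : ℕ} (hN : 3 ≤ N) (m : ℕ) : 0 < cutoff N m (polygonVertex N m) := by
  obtain ⟨h0, h1⟩ := two_pi_div_pos_lt hN
  rw [cutoff_vertex, sub_self, mul_zero, zero_div]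
  exact sub_pos.2 (Real.cos_lt_cos_of_nonneg_of_le_pi le_rfl h1.le h0)

theorem cutoff_left (N m : ℕ) : cutoff N (m + 1) (polygonVertex N m) = 0 := by
  rw [cutoff_vertex]
  push_cast
  rw [add_sub_cancel_left, mul_one, sub_self]

theorem cutoff_right (N m : ℕ) : cutoff N (m + 1) (polygonVertex N (m + 2)) = 0 := by
  rw [cutoff_vertex]
  push_cast
  have : 2 * Real.pi * ((m : ℝ) + 1 - (m + 2)) / N = -(2 * Real.pi / N) := by ring
  rw [this, Real.cos_neg, sub_self]

theorem cutoff_cases {N m j : ℕ} (hN : 3 ≤ N) (hm : m + 1 < N) (hj : j < N) :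
    polygonVertex N j = polygonVertex N (m + 1) ∨ polygonVertex N j = polygonVertex N m ∨
      polygonVertex N j = polygonVertex N (m + 2) ∨ cutoff N (m + 1) (polygonVertex N j) < 0 := by
  by_cases h1 : j = m + 1
  · simp [h1]
  by_cases h2 : j = m
  · simp [h2]
  by_cases h3 : j = m + 2
  · simp [h3]
  -- Wrap-around: here `j = 0` and `m + 2 = N`.
  by_cases h4 : j + N = m + 2
  · right; right; left
    rw [polygonVertex_eq_iff (by omega), ← h4]
    simp [Nat.ModEq]
  right; right; right
  rw [cutoff_vertex, sub_neg]
  have hNr : (0 : ℝ) < N := by exact_mod_cast (by omega : 0 < N)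
  have hpi := Real.pi_pos
  -- All remaining vertices are at an angle strictly between `2π/N` and `2π - 2π/N` from the vertex
  -- `m + 1`.
  have key : ∀ d : ℕ, 1 < d → d + 1 < N →
      Real.cos (2 * Real.pi * d / N) < Real.cos (2 * Real.pi / N) := by
    intro d hd hdN
    have hd' : (1 : ℝ) < d := by exact_mod_cast hd
    have hdN' : (d : ℝ) + 1 < N := by exact_mod_cast hdN
    refine cos_lt_cos_of_mem (two_pi_div_pos_lt hN).1 ?_ ?_
    · rw [div_lt_div_iff_of_pos_right hNr]
      nlinarith
    · rw [lt_sub_iff_add_lt, ← add_div, div_lt_iff₀ hNr]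
      nlinarith
  rcases le_total j (m + 1) with hle | hle
  · have := key (m + 1 - j) (by omega) (by omega)
    rwa [Nat.cast_sub hle] at this
  · have := key (j - (m + 1)) (by omega) (by omega)
    rw [Nat.cast_sub hle] at this
    rw [← Real.cos_neg]
    convert this using 2
    ring

/-- In coordinates rotated by the angle `μ` of the vertex `m + 1`, the line fixes the radial
coordinate `cos δ`, and the unit disc bounds the tangential coordinate `t` by `sin δ`. The ends of
the chord are `t = -sin δ` and `t = sin δ`. -/
theorem mem_segment_of_cutoff_eq_zero {N m : ℕ} (hN : 3 ≤ N) {x : Plane}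
    (hx : x 0 ^ 2 + x 1 ^ 2 ≤ 1) (h : cutoff N (m + 1) x = 0) :
    x ∈ segment ℝ (polygonVertex N m) (polygonVertex N (m + 2)) := by
  obtain ⟨h0, h1⟩ := two_pi_div_pos_lt hN
  have hNr : (N : ℝ) ≠ 0 := by
    have : 0 < N := by omega
    positivity
  set δ := 2 * Real.pi / N with hδ
  have hs := Real.sin_pos_of_pos_of_lt_pi h0 h1
  set μ := 2 * Real.pi * ((m + 1 : ℕ) : ℝ) / N with hμ
  have hm0 : 2 * Real.pi * (m : ℝ) / N = μ - δ := by
    rw [hμ, hδ]; push_cast; ring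
  have hm2 : 2 * Real.pi * ((m + 2 : ℕ) : ℝ) / N = μ + δ := by
    rw [hμ, hδ]; push_cast; ring
  have hx1 : Real.cos μ * x 0 + Real.sin μ * x 1 = Real.cos δ := by
    have := cutoff_apply N (m + 1) x
    rw [h, polygonVertex_zero_coord, polygonVertex_one_coord] at this
    linarith
  have hμ1 := Real.cos_sq_add_sin_sq μ
  have hδ1 := Real.cos_sq_add_sin_sq δ
  set t := -Real.sin μ * x 0 + Real.cos μ * x 1 with ht
  have hsum : Real.cos δ ^ 2 + t ^ 2 = x 0 ^ 2 + x 1 ^ 2 := by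
    rw [← hx1, ht]
    linear_combination (x 0 ^ 2 + x 1 ^ 2) * hμ1
  have ht2 : t ^ 2 ≤ Real.sin δ ^ 2 := by linarith
  obtain ⟨hlo, hhi⟩ := abs_le_of_sq_le_sq' ht2 hs.le
  have e0 : x 0 = Real.cos μ * Real.cos δ - Real.sin μ * t := by
    rw [← hx1, ht]; linear_combination -(x 0) * hμ1
  have e1 : x 1 = Real.sin μ * Real.cos δ + Real.cos μ * t := by
    rw [← hx1, ht]; linear_combination -(x 1) * hμ1
  refine ⟨(Real.sin δ - t) / (2 * Real.sin δ), (Real.sin δ + t) / (2 * Real.sin δ),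
    div_nonneg (by linarith) (by linarith), div_nonneg (by linarith) (by linarith),
    by field_simp; ring, ?_⟩
  ext i
  fin_cases i
  · change _ * polygonVertex N m 0 + _ * polygonVertex N (m + 2) 0 = x 0
    rw [polygonVertex_zero_coord, polygonVertex_zero_coord, hm0, hm2, Real.cos_sub, Real.cos_add, e0]
    field_simp
    ring
  · change _ * polygonVertex N m 1 + _ * polygonVertex N (m + 2) 1 = x 1
    rw [polygonVertex_one_coord, polygonVertex_one_coord, hm0, hm2, Real.sin_sub, Real.sin_add, e1]
    field_simp
    ring

/-- The vertices of the regular `N`-gon. -/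
def polygonVertices (N : ℕ) : Set Plane :=
  Set.range fun i : Fin N => polygonVertex N i

theorem polygonVertex_mem {N : ℕ} (hN : N ≠ 0) (i : ℕ) : polygonVertex N i ∈ polygonVertices N :=
  ⟨⟨i % N, Nat.mod_lt _ (Nat.pos_of_ne_zero hN)⟩,
    (polygonVertex_eq_iff hN _ _).2 (Nat.mod_modEq i N)⟩

theorem polygonVertices_subset_double {n : ℕ} (hn : n ≠ 0) :
    polygonVertices n ⊆ polygonVertices (2 * n) := by
  rintro _ ⟨i, rfl⟩
  simp only
  rw [← polygonVertex_double]
  exact polygonVertex_mem (by omega) _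

/-- Congruence modulo `2 * n` preserves parity. -/
theorem odd_notMem_polygonVertices {n : ℕ} (hn : n ≠ 0) (i : ℕ) :
    polygonVertex (2 * n) (2 * i + 1) ∉ polygonVertices n := by
  rintro ⟨j, hj⟩
  simp only at hj
  rw [← polygonVertex_double, polygonVertex_eq_iff (by omega)] at hj
  have := (hj.of_dvd (Dvd.intro n rfl) : _ ≡ _ [MOD 2])
  unfold Nat.ModEq at this
  omega

theorem mem_closedBall_plane {x : Plane} :
    x ∈ Metric.closedBall (0 : Plane) 1 ↔ x 0 ^ 2 + x 1 ^ 2 ≤ 1 := by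
  rw [mem_closedBall_zero_iff, ← sq_le_one_iff₀ (norm_nonneg _), EuclideanSpace.norm_sq_eq]
  simp [Fin.sum_univ_two]

theorem sq_add_sq_le_of_mem_convexHull {N : ℕ} {x : Plane}
    (hx : x ∈ convexHull ℝ (polygonVertices N)) : x 0 ^ 2 + x 1 ^ 2 ≤ 1 := by
  have h1 : x ∈ Metric.closedBall (0 : Plane) 1 := by
    refine convexHull_min ?_ (convex_closedBall _ _) hx
    rintro _ ⟨i, rfl⟩
    rw [mem_closedBall_plane]
    simp only [polygonVertex_zero_coord, polygonVertex_one_coord]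
    rw [Real.cos_sq_add_sin_sq]
  exact mem_closedBall_plane.1 h1

theorem cutoff_nonpos {n i : ℕ} (hn : 3 ≤ n) (hi : i < n) {x : Plane}
    (hx : x ∈ polygonVertices (2 * n)) (hne : x ≠ polygonVertex (2 * n) (2 * i + 1)) :
    cutoff (2 * n) (2 * i + 1) x ≤ 0 ∧ (cutoff (2 * n) (2 * i + 1) x = 0 →
      x = polygonVertex (2 * n) (2 * i) ∨ x = polygonVertex (2 * n) (2 * i + 2)) := by
  obtain ⟨j, rfl⟩ := hx
  simp only at hne ⊢
  rcases cutoff_cases (N := 2 * n) (m := 2 * i) (by omega) (by omega) j.2 with h | h | h | h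
  · exact (hne h).elim
  · exact ⟨by rw [h, cutoff_left], fun _ => Or.inl h⟩
  · exact ⟨by rw [h, cutoff_right], fun _ => Or.inr h⟩
  · exact ⟨h.le, fun h' => by linarith⟩

/-- Odd vertices are added to the `n`-gon one at a time. Each lies beyond the chord of its
neighbours, so `convexHull_insert_subset` adds only its outer triangle; the unit disc confines the
line to the chord. -/
theorem convexHull_polygon_double_subset {n : ℕ} (hn : 3 ≤ n) :
    convexHull ℝ (polygonVertices (2 * n)) ⊆ convexHull ℝ (polygonVertices n) ∪
      ⋃ i < n, convexHull ℝ (polygonTriangle (2 * n) (2 * i) (2 * i + 1) (2 * i + 2) : Set Plane) := by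
  have hn0 : n ≠ 0 := by omega
  have key : ∀ j ≤ n, convexHull ℝ (polygonVertices n ∪
      (fun i => polygonVertex (2 * n) (2 * i + 1)) '' Set.Iio j) ⊆
      convexHull ℝ (polygonVertices n) ∪ ⋃ i < n,
        convexHull ℝ (polygonTriangle (2 * n) (2 * i) (2 * i + 1) (2 * i + 2) : Set Plane) := by
    intro j
    induction j with
    | zero =>
      intro _
      simp
    | succ j ih =>
      intro hj
      set S := polygonVertices n ∪ (fun i => polygonVertex (2 * n) (2 * i + 1)) '' Set.Iio j with hS
      have hins : polygonVertices n ∪ (fun i => polygonVertex (2 * n) (2 * i + 1)) ''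
          Set.Iio (j + 1) = insert (polygonVertex (2 * n) (2 * j + 1)) S := by
        have : Set.Iio (j + 1) = insert j (Set.Iio j) := by ext; simp
        rw [this, Set.image_insert_eq, Set.union_insert]
      have hSsub : S ⊆ polygonVertices (2 * n) := by
        rintro x (hx | ⟨i, -, rfl⟩)
        · exact polygonVertices_subset_double hn0 hx
        · exact polygonVertex_mem (by omega) _
      have heven : ∀ i, polygonVertex (2 * n) (2 * i) ∈ S := fun i =>
        Or.inl (polygonVertex_double n i ▸ polygonVertex_mem hn0 i)
      rw [hins]
      refine (convexHull_insert_subset (heven j) (heven (j + 1))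
        (g := cutoff (2 * n) (2 * j + 1)) ?_ (cutoff_self_pos (by omega) _) ?_).trans ?_
      · intro y hy
        refine (cutoff_nonpos hn (by omega) (hSsub hy) ?_).1
        rintro rfl
        rcases hy with hy | ⟨i, hi, hy⟩
        · exact odd_notMem_polygonVertices hn0 _ hy
        · simp only [Set.mem_Iio] at hi
          simp only at hy
          rw [polygonVertex_eq_iff (by omega)] at hy
          have := hy.eq_of_lt_of_lt (by omega) (by omega)
          omega
      · intro z hz hgz
        refine mem_segment_of_cutoff_eq_zero (by omega) ?_ hgz
        refine sq_add_sq_le_of_mem_convexHull (N := 2 * n) (convexHull_mono ?_ hz)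
        exact Set.insert_subset (polygonVertex_mem (by omega) _) hSsub
      · refine Set.union_subset (ih (by omega)) fun x hx => Or.inr ?_
        simp only [Set.mem_iUnion]
        refine ⟨j, by omega, ?_⟩
        convert hx using 2
        simp [polygonTriangle, mul_add]
  refine Set.Subset.trans (convexHull_mono ?_) (key n le_rfl)
  rintro _ ⟨j, rfl⟩
  have hj := j.2
  rcases Nat.even_or_odd' j.1 with ⟨i, h | h⟩
  · left
    simp only [h, polygonVertex_double]
    exact polygonVertex_mem hn0 i
  · right
    exact ⟨i, by simp only [Set.mem_Iio]; omega, by simp only [h]⟩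

theorem affineIndependent_polygonTriangle {N m : ℕ} (hN : 3 ≤ N) :
    AffineIndependent ℝ ((↑) : polygonTriangle N m (m + 1) (m + 2) → Plane) := by
  refine affineIndependent_triple (g := cutoff N (m + 1)) ?_ (cutoff_left N m) (cutoff_right N m)
    (cutoff_self_pos hN _).ne'
  rw [Ne, polygonVertex_eq_iff (by omega), ← Int.natCast_modEq_iff, Int.modEq_iff_dvd]
  rintro ⟨d, hd⟩
  push_cast at hd
  have hd2 : (N : ℤ) * d = 2 := by linarith
  have := Int.le_of_dvd (by norm_num) (Dvd.intro _ hd2)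
  omega

theorem card_polygonTriangle {N m : ℕ} (hN : 3 ≤ N) :
    (polygonTriangle N m (m + 1) (m + 2)).card = 3 := by
  have key : ∀ i j, i < j → j < i + 3 → polygonVertex N i ≠ polygonVertex N j := by
    intro i j hij hj
    rw [Ne, polygonVertex_eq_iff (by omega), ← Int.natCast_modEq_iff, Int.modEq_iff_dvd]
    intro hd
    have := Int.le_of_dvd (by omega) hd
    omega
  exact Finset.card_eq_three.2 ⟨_, _, _, key _ _ (by omega) (by omega),
    key _ _ (by omega) (by omega), key _ _ (by omega) (by omega), rfl⟩

theorem coe_subset_polygonVertices {k : ℕ} {T : Finset Plane} (hT : T ∈ recursiveTriangles k) :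
    (T : Set Plane) ⊆ polygonVertices (3 * 2 ^ k) := by
  have hsub : ∀ N a b c, N ≠ 0 → (polygonTriangle N a b c : Set Plane) ⊆ polygonVertices N := by
    intro N a b c hN
    simp only [polygonTriangle, Finset.coe_insert, Finset.coe_singleton, Set.insert_subset_iff,
      Set.singleton_subset_iff]
    exact ⟨polygonVertex_mem hN _, polygonVertex_mem hN _, polygonVertex_mem hN _⟩
  induction k with
  | zero =>
    rw [Set.mem_singleton_iff.1 hT]
    exact hsub _ _ _ _ (by norm_num)
  | succ k ih =>
    have hpow : 3 * 2 ^ (k + 1) = 2 * (3 * 2 ^ k) := by ring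
    rcases hT with ⟨i, -, rfl⟩ | hT
    · exact hsub _ _ _ _ (by positivity)
    · rw [hpow]
      exact (ih hT).trans (polygonVertices_subset_double (by positivity))

theorem affineIndependent_of_mem_recursiveTriangles {k : ℕ} {T : Finset Plane}
    (hT : T ∈ recursiveTriangles k) :
    AffineIndependent ℝ ((↑) : T → Plane) ∧ T.card = 3 := by
  induction k with
  | zero =>
    rw [Set.mem_singleton_iff.1 hT]
    exact ⟨affineIndependent_polygonTriangle le_rfl, card_polygonTriangle le_rfl⟩
  | succ k ih =>
    rcases hT with ⟨i, -, rfl⟩ | hT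
    · have hN : 3 ≤ 3 * 2 ^ (k + 1) := Nat.le_mul_of_pos_right _ (by positivity)
      exact ⟨affineIndependent_polygonTriangle hN, card_polygonTriangle hN⟩
    · exact ih hT

theorem three_le_three_mul_two_pow (k : ℕ) : 3 ≤ 3 * 2 ^ k :=
  Nat.le_mul_of_pos_right _ (by positivity)

/-- An outer triangle is separated from the other triangles by the side that it cuts off. -/
theorem inter_subset_of_outer {n i : ℕ} (hn : 3 ≤ n) (hi : i < n) {s t : Finset Plane}
    (hs : s ⊆ polygonTriangle (2 * n) (2 * i) (2 * i + 1) (2 * i + 2))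
    (ht : (t : Set Plane) ⊆ polygonVertices (2 * n))
    (hne : polygonVertex (2 * n) (2 * i + 1) ∉ t) :
    convexHull ℝ (s : Set Plane) ∩ convexHull ℝ (t : Set Plane) ⊆ convexHull ℝ (s ∩ t) := by
  have hs' : ∀ y ∈ s, y = polygonVertex (2 * n) (2 * i) ∨ y = polygonVertex (2 * n) (2 * i + 1) ∨
      y = polygonVertex (2 * n) (2 * i + 2) := fun y hy => by
    simpa [polygonTriangle] using hs hy
  have hpos := cutoff_self_pos (N := 2 * n) (by omega) (2 * i + 1)
  have ht' := fun y (hy : y ∈ t) => cutoff_nonpos hn hi (ht hy) (by rintro rfl; exact hne hy)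
  refine inter_subset_of_separated (g := cutoff (2 * n) (2 * i + 1)) ?_ (fun y hy => (ht' y hy).1)
    ?_ (fun y hy => (ht' y hy).2)
  · intro y hy
    rcases hs' y hy with rfl | rfl | rfl
    · rw [cutoff_left]
    · exact hpos.le
    · rw [cutoff_right]
  · intro y hy h0
    rcases hs' y hy with rfl | rfl | rfl
    · exact Or.inl rfl
    · exact (hpos.ne' h0).elim
    · exact Or.inr rfl

theorem odd_notMem_outer {n i j : ℕ} (hi : i < n) (hj : j < n) (hij : i ≠ j) :
    polygonVertex (2 * n) (2 * i + 1) ∉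
      polygonTriangle (2 * n) (2 * j) (2 * j + 1) (2 * j + 2) := by
  simp only [polygonTriangle, Finset.mem_insert, Finset.mem_singleton]
  rw [polygonVertex_eq_iff (by omega), polygonVertex_eq_iff (by omega),
    polygonVertex_eq_iff (by omega)]
  rintro (h | h | h)
  · have := (h.of_dvd (Dvd.intro n rfl) : _ ≡ _ [MOD 2])
    unfold Nat.ModEq at this
    omega
  · have := h.eq_of_lt_of_lt (by omega) (by omega)
    omega
  · have := (h.of_dvd (Dvd.intro n rfl) : _ ≡ _ [MOD 2])
    unfold Nat.ModEq at this
    omega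

/-- Of two different triangles either one is outer, and its chord separates them, or both belong to
the inner polygon and induction applies. Within one triangle affine independence suffices. -/
theorem inter_subset_of_subset_recursiveTriangles {k : ℕ} {T T' s t : Finset Plane}
    (hT : T ∈ recursiveTriangles k) (hT' : T' ∈ recursiveTriangles k) (hs : s ⊆ T) (ht : t ⊆ T') :
    convexHull ℝ (s : Set Plane) ∩ convexHull ℝ (t : Set Plane) ⊆ convexHull ℝ (s ∩ t) := by
  have same : ∀ {k : ℕ} {T : Finset Plane}, T ∈ recursiveTriangles k → s ⊆ T → t ⊆ T →
      convexHull ℝ (s : Set Plane) ∩ convexHull ℝ (t : Set Plane) ⊆ convexHull ℝ (s ∩ t) :=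
    fun hT hs ht =>
      ((affineIndependent_of_mem_recursiveTriangles hT).1.convexHull_inter hs ht).symm.subset
  induction k generalizing T T' s t with
  | zero =>
    rw [Set.mem_singleton_iff.1 hT'] at ht
    rw [Set.mem_singleton_iff.1 hT] at hs
    exact same (k := 0) rfl hs ht
  | succ k ih =>
    have hpow : 3 * 2 ^ (k + 1) = 2 * (3 * 2 ^ k) := by ring
    have hn := three_le_three_mul_two_pow k
    have hsV := (Finset.coe_subset.2 hs).trans (coe_subset_polygonVertices hT)
    have htV := (Finset.coe_subset.2 ht).trans (coe_subset_polygonVertices hT')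
    have hT0 := hT
    rcases hT with ⟨i, hi, rfl⟩ | hT <;> rcases hT' with ⟨j, hj, rfl⟩ | hT'
    · by_cases hij : i = j
      · subst hij
        exact same hT0 hs ht
      · rw [hpow] at hs ht htV
        exact inter_subset_of_outer hn hi hs htV fun h => odd_notMem_outer hi hj hij (ht h)
    · rw [hpow] at hs htV
      exact inter_subset_of_outer hn hi hs htV fun h =>
        odd_notMem_polygonVertices (by omega) _ (coe_subset_polygonVertices hT' (ht h))
    · rw [hpow] at ht hsV
      rw [Set.inter_comm, Set.inter_comm (s : Set Plane)]
      exact inter_subset_of_outer hn hj ht hsV fun h =>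
        odd_notMem_polygonVertices (by omega) _ (coe_subset_polygonVertices hT (hs h))
    · exact ih hT hT' hs ht fun hT hs ht =>
        ((affineIndependent_of_mem_recursiveTriangles hT).1.convexHull_inter hs ht).symm.subset

/-- The recursive triangulation of the regular `3 * 2 ^ k`-gon. -/
def recursiveModel (k : ℕ) : SimplicialComplex ℝ Plane where
  faces := {s | s.Nonempty ∧ ∃ T ∈ recursiveTriangles k, s ⊆ T}
  isRelLowerSet_faces := fun s hs => ⟨hs.1, fun t hts ht =>
    ⟨ht, hs.2.imp fun T hT => ⟨hT.1, hts.trans hT.2⟩⟩⟩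
  indep := by
    rintro s ⟨-, T, hT, hs⟩
    exact (affineIndependent_of_mem_recursiveTriangles hT).1.mono (Finset.coe_subset.2 hs)
  inter_subset_convexHull := by
    rintro s t ⟨-, T, hT, hs⟩ ⟨-, T', hT', ht⟩
    exact inter_subset_of_subset_recursiveTriangles hT hT' hs ht

theorem mem_faces_recursiveModel {k : ℕ} {T : Finset Plane} (hT : T ∈ recursiveTriangles k) :
    T ∈ (recursiveModel k).faces :=
  ⟨Finset.card_pos.1 (by rw [(affineIndependent_of_mem_recursiveTriangles hT).2]; norm_num),
    T, hT, subset_rfl⟩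

theorem triangles_recursiveModel (k : ℕ) :
    triangles (recursiveModel k) = recursiveTriangles k := by
  ext T
  constructor
  · rintro ⟨⟨-, T', hT', h⟩, h3⟩
    rwa [Finset.eq_of_subset_of_card_le h
      (by rw [h3, (affineIndependent_of_mem_recursiveTriangles hT').2])]
  · intro hT
    exact ⟨mem_faces_recursiveModel hT, (affineIndependent_of_mem_recursiveTriangles hT).2⟩

theorem finite_recursiveTriangles (k : ℕ) : (recursiveTriangles k).Finite := by
  induction k with
  | zero => exact Set.finite_singleton _
  | succ k ih =>
    refine Set.Finite.union (((Set.finite_Iio (3 * 2 ^ k)).image fun i =>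
      polygonTriangle (3 * 2 ^ (k + 1)) (2 * i) (2 * i + 1) (2 * i + 2)).subset ?_) ih
    rintro _ ⟨i, hi, rfl⟩
    exact ⟨i, hi, rfl⟩

theorem nonempty_recursiveTriangles (k : ℕ) : (recursiveTriangles k).Nonempty := by
  induction k with
  | zero => exact ⟨_, rfl⟩
  | succ k ih => exact ih.mono Set.subset_union_right

theorem isTriangulatedModel_recursiveModel (k : ℕ) : IsTriangulatedModel (recursiveModel k) := by
  classical
  refine ⟨?_, ?_, ?_⟩
  · refine ((finite_recursiveTriangles k).biUnion fun T _ => T.powerset.finite_toSet).subset ?_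
    rintro s ⟨-, T, hT, hs⟩
    exact Set.mem_biUnion hT (by simpa using hs)
  · exact (nonempty_recursiveTriangles k).mono fun T hT => mem_faces_recursiveModel hT
  · rintro s ⟨-, T, hT, hs⟩
    exact ⟨T, (triangles_recursiveModel k).symm ▸ hT, hs⟩

theorem iUnion_recursiveTriangles (k : ℕ) :
    ⋃ T ∈ recursiveTriangles k, convexHull ℝ (T : Set Plane) =
      convexHull ℝ (polygonVertices (3 * 2 ^ k)) := by
  refine Set.Subset.antisymm
    (Set.iUnion₂_subset fun T hT => convexHull_mono (coe_subset_polygonVertices hT)) ?_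
  induction k with
  | zero =>
    refine Set.Subset.trans (convexHull_mono ?_)
      (Set.subset_biUnion_of_mem (u := fun T : Finset Plane => convexHull ℝ (T : Set Plane))
        (show polygonTriangle 3 0 1 2 ∈ recursiveTriangles 0 from rfl))
    rintro _ ⟨i, rfl⟩
    have hi : (i : ℕ) < 3 := by simp
    simp only [polygonTriangle, Finset.coe_insert, Finset.coe_singleton, Set.mem_insert_iff,
      Set.mem_singleton_iff, pow_zero, mul_one]
    interval_cases (i : ℕ) <;> simp
  | succ k ih =>
    have hpow : 3 * 2 ^ (k + 1) = 2 * (3 * 2 ^ k) := by ring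
    rw [hpow]
    refine (convexHull_polygon_double_subset (three_le_three_mul_two_pow k)).trans
      (Set.union_subset (ih.trans (Set.biUnion_subset_biUnion_left Set.subset_union_right)) ?_)
    refine Set.iUnion₂_subset fun i hi => ?_
    refine Set.subset_biUnion_of_mem (u := fun T : Finset Plane => convexHull ℝ (T : Set Plane))
      (Or.inl ⟨i, hi, ?_⟩)
    rw [hpow]

theorem space_recursiveModel (k : ℕ) :
    (recursiveModel k).space = convexHull ℝ (polygonVertices (3 * 2 ^ k)) := by
  rw [← iUnion_recursiveTriangles]
  refine Set.Subset.antisymm (Set.iUnion₂_subset ?_) (Set.iUnion₂_subset ?_)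
  · rintro s ⟨-, T, hT, hs⟩
    exact (convexHull_mono (Finset.coe_subset.2 hs)).trans
      (Set.subset_biUnion_of_mem (u := fun T : Finset Plane => convexHull ℝ (T : Set Plane)) hT)
  · intro T hT
    exact SimplicialComplex.convexHull_subset_space (mem_faces_recursiveModel hT)

end Polygon

/-! ### The topology of the model -/

section Hemisphere

local notation "Plane" => EuclideanSpace ℝ (Fin 2)

theorem mem_sphereWithHole {y : EuclideanSpace ℝ (Fin 3)} :
    y ∈ sphereWithHole ↔ y 0 ^ 2 + y 1 ^ 2 + y 2 ^ 2 = 1 ∧ y 2 ≤ 0 := by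
  have h : ‖y‖ = 1 ↔ y 0 ^ 2 + y 1 ^ 2 + y 2 ^ 2 = 1 := by
    rw [← pow_eq_one_iff_of_nonneg (norm_nonneg y) two_ne_zero, EuclideanSpace.norm_sq_eq]
    simp [Fin.sum_univ_three]
  rw [← h]
  rfl

/-- The vertical projection from the lower hemisphere to the disc. -/
noncomputable def discHomeomorphSphereWithHole :
    Metric.closedBall (0 : Plane) 1 ≃ₜ sphereWithHole where
  toFun x := ⟨!₂[x.1 0, x.1 1, -√(1 - x.1 0 ^ 2 - x.1 1 ^ 2)], by
    have hx := mem_closedBall_plane.1 x.2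
    rw [mem_sphereWithHole]
    have h := Real.sq_sqrt (show 0 ≤ 1 - x.1 0 ^ 2 - x.1 1 ^ 2 by linarith)
    have h' := Real.sqrt_nonneg (1 - x.1 0 ^ 2 - x.1 1 ^ 2)
    simp only [Matrix.cons_val]
    exact ⟨by rw [neg_sq, h]; ring, by linarith⟩⟩
  invFun y := ⟨!₂[y.1 0, y.1 1], by
    have hy := (mem_sphereWithHole.1 y.2).1
    rw [mem_closedBall_plane]
    simp only [Matrix.cons_val]
    nlinarith [sq_nonneg (y.1 2)]⟩
  left_inv x := by
    apply Subtype.ext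
    ext i
    fin_cases i <;> rfl
  right_inv y := by
    obtain ⟨hy, hy'⟩ := mem_sphereWithHole.1 y.2
    apply Subtype.ext
    ext i
    fin_cases i
    · rfl
    · rfl
    · change -√(1 - y.1 0 ^ 2 - y.1 1 ^ 2) = y.1 2
      have : 1 - y.1 0 ^ 2 - y.1 1 ^ 2 = (-y.1 2) ^ 2 := by linarith
      rw [this, Real.sqrt_sq (by linarith), neg_neg]
  continuous_toFun := by
    refine Continuous.subtype_mk ((PiLp.continuous_toLp 2 _).comp (continuous_pi fun i => ?_)) _
    fin_cases i <;> simp <;> fun_prop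
  continuous_invFun := by
    refine Continuous.subtype_mk ((PiLp.continuous_toLp 2 _).comp (continuous_pi fun i => ?_)) _
    fin_cases i <;> simp <;> fun_prop

theorem nonempty_interior_polygon (k : ℕ) :
    (interior (convexHull ℝ (polygonVertices (3 * 2 ^ k)))).Nonempty := by
  obtain ⟨T, hT⟩ := nonempty_recursiveTriangles k
  obtain ⟨hind, hcard⟩ := affineIndependent_of_mem_recursiveTriangles hT
  refine Set.Nonempty.mono (interior_mono (convexHull_mono (coe_subset_polygonVertices hT))) ?_
  rw [interior_convexHull_nonempty_iff_affineSpan_eq_top]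
  have := hind.affineSpan_eq_top_iff_card_eq_finrank_add_one.2 (by simp [hcard])
  simpa using this

/-- A compact convex set with nonempty interior is a closed disc, and the disc is the vertical
projection of the lower hemisphere. -/
theorem nonempty_homeomorph_sphereWithHole (k : ℕ) :
    Nonempty ((recursiveModel k).space ≃ₜ sphereWithHole) := by
  rw [space_recursiveModel]
  have hcpt : IsCompact (convexHull ℝ (polygonVertices (3 * 2 ^ k))) :=
    (Set.finite_range _).isCompact_convexHull ℝ
  obtain ⟨h, -, hcl, -⟩ := exists_homeomorph_image_interior_closure_frontier_eq_unitBall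
    (convex_convexHull ℝ _) (nonempty_interior_polygon k) hcpt.isBounded
  rw [hcpt.isClosed.closure_eq] at hcl
  exact ⟨((h.image _).trans (Homeomorph.setCongr hcl)).trans discHomeomorphSphereWithHole⟩

end Hemisphere

/-! ### Trees from parent functions -/

/-- A graph given by a parent function is a complete cubic tree if the numbers of children are
right. -/
theorem isCompleteCubicTree_of_parent {V : Type*} [Finite V] {G : SimpleGraph V} {k : ℕ}
    {depth : V → ℕ} {par : V → V} {r : V} (hr : depth r = 0)
    (hpar : ∀ v, v ≠ r → depth v = depth (par v) + 1)
    (hadj : ∀ u v, G.Adj u v ↔ (u ≠ r ∧ par u = v) ∨ (v ≠ r ∧ par v = u))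
    (hk : ∀ v, depth v ≤ k) (hroot : 0 < k → {u | u ≠ r ∧ par u = r}.ncard = 3)
    (hchild : ∀ v, v ≠ r → depth v < k → {u | u ≠ r ∧ par u = v}.ncard = 2) :
    IsCompleteCubicTree G k := by
  classical
  have hwalk : ∀ n v, depth v = n → ∃ w : G.Walk r v, w.length = n := by
    intro n
    induction n with
    | zero =>
      intro v hv
      have : v = r := by
        by_contra hne
        have := hpar v hne
        omega
      subst this
      exact ⟨.nil, rfl⟩
    | succ n ih =>
      intro v hv
      have hne : v ≠ r := by rintro rfl; omega
      have := hpar v hne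
      obtain ⟨w, hw⟩ := ih (par v) (by omega)
      exact ⟨w.concat ((hadj _ _).2 (Or.inr ⟨hne, rfl⟩)), by simp [hw]⟩
  -- Depth changes by one along each edge; with `hwalk` this identifies distance from the root with
  -- depth.
  have hlow : ∀ u v (w : G.Walk u v), depth v ≤ depth u + w.length := by
    intro u v w
    induction w with
    | nil => simp
    | cons h w ih =>
      rw [SimpleGraph.Walk.length_cons]
      rcases (hadj _ _).1 h with ⟨h1, rfl⟩ | ⟨h1, rfl⟩
      · have := hpar _ h1; omega
      · have := hpar _ h1; omega
  have hconn : G.Connected := by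
    have : Nonempty V := ⟨r⟩
    refine SimpleGraph.Connected.mk fun u v => ?_
    obtain ⟨w, -⟩ := hwalk _ u rfl
    obtain ⟨w', -⟩ := hwalk _ v rfl
    exact ⟨w.reverse.append w'⟩
  have hdist : ∀ v, G.dist r v = depth v := by
    intro v
    obtain ⟨w, hw⟩ := hwalk _ v rfl
    obtain ⟨w', hw'⟩ := hconn.exists_walk_length_eq_dist r v
    have h1 := SimpleGraph.dist_le w
    have h2 := hlow r v w'
    omega
  have hnbr : ∀ v, v ≠ r → G.neighborSet v = insert (par v) {u | u ≠ r ∧ par u = v} := by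
    intro v hv
    ext u
    simp only [SimpleGraph.mem_neighborSet, hadj, Set.mem_insert_iff, Set.mem_ofPred_eq]
    constructor
    · rintro (⟨-, h⟩ | h)
      · exact Or.inl h.symm
      · exact Or.inr h
    · rintro (h | h)
      · exact Or.inl ⟨hv, h.symm⟩
      · exact Or.inr h
  have hnbr_root : G.neighborSet r = {u | u ≠ r ∧ par u = r} := by
    ext u
    simp [hadj]
  refine ⟨?_, r, fun v => ?_⟩
  · rw [SimpleGraph.isTree_iff_connected_and_card]
    refine ⟨hconn, le_antisymm ?_ hconn.card_vert_le_card_edgeSet_add_one⟩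
    -- Every edge joins a non-root node to its parent, so there are at most as many edges as
    -- non-root nodes, which forces a connected graph to be a tree.
    have hsurj : Function.Surjective (fun v : {v // v ≠ r} =>
        (⟨s(v.1, par v.1), (hadj _ _).2 (Or.inl ⟨v.2, rfl⟩)⟩ : G.edgeSet)) := by
      rintro ⟨e, he⟩
      induction e with
      | h a b =>
        rcases (hadj a b).1 he with ⟨h, rfl⟩ | ⟨h, rfl⟩
        · exact ⟨⟨a, h⟩, rfl⟩
        · exact ⟨⟨b, h⟩, Subtype.ext Sym2.eq_swap⟩
    have h1 : Nat.card G.edgeSet ≤ Nat.card {v // v ≠ r} :=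
      Nat.card_le_card_of_surjective _ hsurj
    have h2 : Nat.card {v // v ≠ r} + 1 = Nat.card V := by
      have := Set.ncard_add_ncard_compl ({r} : Set V)
      rw [Set.ncard_singleton, add_comm] at this
      exact this
    omega
  · rw [hdist]
    refine ⟨hk v, fun hlt => ?_, fun heq => ?_⟩
    · by_cases hv : v = r
      · subst hv
        rw [hnbr_root]
        exact hroot (by omega)
      · rw [hnbr v hv, Set.ncard_insert_of_notMem, hchild v hv hlt]
        rintro ⟨h1, h2⟩
        have h3 := hpar v hv
        have h4 := hpar _ h1
        rw [h2] at h4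
        omega
    · have hempty : {u | u ≠ r ∧ par u = v} = ∅ := by
        ext u
        simp only [Set.mem_ofPred_eq, Set.mem_empty_iff_false, iff_false, not_and]
        rintro hu rfl
        have := hpar u hu
        have := hk u
        omega
      by_cases hv : v = r
      · subst hv
        rw [hnbr_root, hempty, Set.ncard_empty]
        omega
      · rw [hnbr v hv, hempty, insert_empty_eq, Set.ncard_singleton]

/-! ### The dual graph in terms of levels and indices -/

section DualTree

local notation "Plane" => EuclideanSpace ℝ (Fin 2)

/-- The number of triangles at a given depth. -/
def levelCard : ℕ → ℕ
  | 0 => 1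
  | j + 1 => 3 * 2 ^ j

/-- The triangle number `i` at depth `j`. -/
noncomputable def levelTriangle : ℕ → ℕ → Finset Plane
  | 0, _ => polygonTriangle 3 0 1 2
  | j + 1, i => polygonTriangle (3 * 2 ^ (j + 1)) (2 * i) (2 * i + 1) (2 * i + 2)

open Classical in
/-- The side number `i` of the regular `3 * 2 ^ j`-gon. -/
noncomputable def polygonSide (j i : ℕ) : Finset Plane :=
  {polygonVertex (3 * 2 ^ j) i, polygonVertex (3 * 2 ^ j) (i + 1)}

/-- `polygonSide l m` is a side of the triangle number `i` at depth `j`. -/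
def HasSide : ℕ → ℕ → ℕ → ℕ → Prop
  | 0, _, l, m => l = 0 ∧ m < 3
  | j + 1, i, l, m => (l = j ∧ m = i) ∨ (l = j + 1 ∧ m / 2 = i)

/-- The triangle number `i` at depth `j` is a child of the triangle number `i'` at depth `j'`. -/
def IsChild (j i j' i' : ℕ) : Prop :=
  j = j' + 1 ∧ (j' = 0 ∨ i / 2 = i')

theorem mem_recursiveTriangles_iff {k : ℕ} {T : Finset Plane} : T ∈ recursiveTriangles k ↔
    ∃ j i, j ≤ k ∧ i < levelCard j ∧ levelTriangle j i = T := by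
  induction k with
  | zero =>
    constructor
    · intro h
      exact ⟨0, 0, le_rfl, by simp [levelCard], (Set.mem_singleton_iff.1 h).symm⟩
    · rintro ⟨j, i, hj, -, rfl⟩
      obtain rfl : j = 0 := by omega
      rfl
  | succ k ih =>
    constructor
    · rintro (⟨i, hi, rfl⟩ | h)
      · exact ⟨k + 1, i, le_rfl, hi, rfl⟩
      · obtain ⟨j, i, hj, h⟩ := ih.1 h
        exact ⟨j, i, by omega, h⟩
    · rintro ⟨j, i, hj, hi, rfl⟩
      rcases Nat.lt_or_ge k j with hlt | hge
      · obtain rfl : j = k + 1 := by omega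
        exact Or.inl ⟨i, hi, rfl⟩
      · exact Or.inr (ih.2 ⟨j, i, hge, hi, rfl⟩)

theorem eq_pair_of_subset_triple {α : Type*} [DecidableEq α] {e : Finset α} {a b c : α}
    (he : e.card = 2) (h : e ⊆ {a, b, c}) : e = {a, b} ∨ e = {b, c} ∨ e = {a, c} := by
  obtain ⟨x, y, hxy, rfl⟩ := Finset.card_eq_two.1 he
  have hx := h (show x ∈ ({x, y} : Finset α) by simp)
  have hy := h (show y ∈ ({x, y} : Finset α) by simp)
  simp only [Finset.mem_insert, Finset.mem_singleton] at hx hy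
  rcases hx with rfl | rfl | rfl <;> rcases hy with rfl | rfl | rfl <;>
    simp_all [Finset.pair_comm]

theorem pow_double (j : ℕ) : 3 * 2 ^ (j + 1) = 2 * (3 * 2 ^ j) := by ring

theorem polygonSide_two : polygonSide 0 2 = {polygonVertex 3 2, polygonVertex 3 0} := by
  have : polygonVertex 3 3 = polygonVertex 3 0 :=
    (polygonVertex_eq_iff (by norm_num) _ _).2 (by simp [Nat.ModEq])
  simp [polygonSide, this]

theorem polygonSide_eq_double (j i : ℕ) : polygonSide j i =
    {polygonVertex (3 * 2 ^ (j + 1)) (2 * i), polygonVertex (3 * 2 ^ (j + 1)) (2 * i + 2)} := by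
  rw [pow_double, polygonVertex_double, show 2 * i + 2 = 2 * (i + 1) by ring, polygonVertex_double]
  rfl

theorem exists_side_eq {j i : ℕ} {e : Finset Plane} (he : e.card = 2)
    (h : e ⊆ levelTriangle j i) : ∃ l m, HasSide j i l m ∧ e = polygonSide l m := by
  cases j with
  | zero =>
    rcases eq_pair_of_subset_triple he h with rfl | rfl | rfl
    · exact ⟨0, 0, ⟨rfl, by norm_num⟩, rfl⟩
    · exact ⟨0, 1, ⟨rfl, by norm_num⟩, rfl⟩
    · exact ⟨0, 2, ⟨rfl, by norm_num⟩, by rw [polygonSide_two, Finset.pair_comm]⟩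
  | succ j =>
    rcases eq_pair_of_subset_triple he h with rfl | rfl | rfl
    · exact ⟨j + 1, 2 * i, Or.inr ⟨rfl, by omega⟩, rfl⟩
    · exact ⟨j + 1, 2 * i + 1, Or.inr ⟨rfl, by omega⟩, rfl⟩
    · exact ⟨j, i, Or.inl ⟨rfl, rfl⟩, (polygonSide_eq_double j i).symm⟩

theorem polygonSide_subset {j i l m : ℕ} (h : HasSide j i l m) :
    polygonSide l m ⊆ levelTriangle j i := by
  classical
  cases j with
  | zero =>
    obtain ⟨rfl, hm⟩ := h
    simp only [levelTriangle, polygonTriangle]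
    interval_cases m
    · simp [polygonSide, Finset.insert_subset_iff]
    · simp [polygonSide]
    · rw [polygonSide_two]
      simp [Finset.insert_subset_iff]
  | succ j =>
    simp only [levelTriangle, polygonTriangle]
    rcases h with ⟨rfl, rfl⟩ | ⟨rfl, rfl⟩
    · rw [polygonSide_eq_double]
      simp [Finset.insert_subset_iff]
    · rcases Nat.even_or_odd' m with ⟨n, rfl | rfl⟩
      · rw [Nat.mul_div_cancel_left n two_pos]
        simp [polygonSide, Finset.insert_subset_iff]
      · rw [show (2 * n + 1) / 2 = n by omega]
        simp [polygonSide]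

theorem card_polygonSide (j i : ℕ) : (polygonSide j i).card = 2 := by
  classical
  have hN := three_le_three_mul_two_pow j
  refine Finset.card_pair ?_
  rw [Ne, polygonVertex_eq_iff (by omega), ← Int.natCast_modEq_iff, Int.modEq_iff_dvd]
  intro hd
  have := Int.le_of_dvd (by omega) hd
  omega

theorem HasSide.lt {j i l m : ℕ} (h : HasSide j i l m) (hi : i < levelCard j) : m < 3 * 2 ^ l := by
  cases j with
  | zero => obtain ⟨rfl, hm⟩ := h; simpa using hm
  | succ j =>
    simp only [levelCard] at hi
    rcases h with ⟨rfl, rfl⟩ | ⟨rfl, rfl⟩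
    · exact hi
    · rw [pow_double]; omega

/-- The inner product of the ends of a side is `cos (2π/N)`, which determines `N` and so the level.
An end then determines the index; matching the ends in reverse would make `N` divide `2`. -/
theorem polygonSide_injective {l m l' m' : ℕ} (hm : m < 3 * 2 ^ l) (hm' : m' < 3 * 2 ^ l')
    (h : polygonSide l m = polygonSide l' m') : l = l' ∧ m = m' := by
  classical
  have hN := three_le_three_mul_two_pow l
  have hN' := three_le_three_mul_two_pow l'
  have hc : ∀ N i, polygonVertex N i 0 * polygonVertex N (i + 1) 0 +
      polygonVertex N i 1 * polygonVertex N (i + 1) 1 = Real.cos (2 * Real.pi / N) := by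
    intro N i
    rw [cos_sub_polygon, ← Real.cos_neg]
    congr 1
    push_cast
    ring
  have hpair : ({polygonVertex (3 * 2 ^ l) m, polygonVertex (3 * 2 ^ l) (m + 1)} : Set Plane) =
      {polygonVertex (3 * 2 ^ l') m', polygonVertex (3 * 2 ^ l') (m' + 1)} := by
    have := congrArg (fun s : Finset Plane => (s : Set Plane)) h
    simpa [polygonSide] using this
  rw [Set.pair_eq_pair_iff] at hpair
  have hcos : Real.cos (2 * Real.pi / (3 * 2 ^ l : ℕ)) =
      Real.cos (2 * Real.pi / (3 * 2 ^ l' : ℕ)) := by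
    rw [← hc _ m, ← hc _ m']
    rcases hpair with ⟨h1, h2⟩ | ⟨h1, h2⟩
    · rw [h1, h2]
    · rw [h1, h2]; ring
  obtain ⟨p0, p1⟩ := two_pi_div_pos_lt hN
  obtain ⟨p0', p1'⟩ := two_pi_div_pos_lt hN'
  have hdiv := Real.injOn_cos ⟨p0.le, p1.le⟩ ⟨p0'.le, p1'.le⟩ hcos
  have hpi := Real.pi_ne_zero
  have hNN : 3 * 2 ^ l = 3 * 2 ^ l' := by
    rw [div_eq_div_iff (by positivity) (by positivity)] at hdiv
    exact_mod_cast (mul_left_cancel₀ (by positivity) hdiv).symm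
  obtain rfl : l = l' := Nat.pow_right_injective le_rfl (by simpa using hNN)
  refine ⟨rfl, ?_⟩
  simp only [polygonVertex_eq_iff (show 3 * 2 ^ l ≠ 0 by omega)] at hpair
  rcases hpair with ⟨h1, -⟩ | ⟨h1, h2⟩
  · exact h1.eq_of_lt_of_lt hm hm'
  · exfalso
    have h3 : m + 2 ≡ m + 0 [MOD 3 * 2 ^ l] := (h2.add_right 1).trans h1.symm
    have h4 := Nat.ModEq.add_left_cancel' m h3
    rw [Nat.modEq_zero_iff_dvd] at h4
    have := Nat.le_of_dvd two_pos h4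
    omega

theorem IsChild.exists_side {j i j' i' : ℕ} (h : IsChild j i j' i') (hi : i < levelCard j) :
    ∃ l m, HasSide j i l m ∧ HasSide j' i' l m := by
  obtain ⟨rfl, h⟩ := h
  refine ⟨j', i, Or.inl ⟨rfl, rfl⟩, ?_⟩
  cases j' with
  | zero => exact ⟨rfl, by simpa [levelCard] using hi⟩
  | succ j' => exact Or.inr ⟨rfl, h.resolve_left (by omega)⟩

/-- Side `m` of level `l` has only two possible owners: triangle `m` at depth `l + 1` outside it,
and triangle `m / 2` at depth `l` inside it (the central triangle if `l = 0`). -/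
theorem eq_or_isChild_of_side {j i j' i' l m : ℕ} (hi : i < levelCard j) (hi' : i' < levelCard j')
    (h : HasSide j i l m) (h' : HasSide j' i' l m) :
    (j = j' ∧ i = i') ∨ IsChild j i j' i' ∨ IsChild j' i' j i := by
  have h0 : levelCard 0 = 1 := rfl
  cases j <;> cases j' <;> simp only [HasSide, IsChild, true_and, true_or, and_true] at * <;> omega

theorem exists_common_side {j i j' i' : ℕ} {e : Finset Plane} (hi : i < levelCard j)
    (hi' : i' < levelCard j') (he : e.card = 2) (h : e ⊆ levelTriangle j i)
    (h' : e ⊆ levelTriangle j' i') : ∃ l m, HasSide j i l m ∧ HasSide j' i' l m := by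
  obtain ⟨l, m, hlm, rfl⟩ := exists_side_eq he h
  obtain ⟨l', m', hlm', heq⟩ := exists_side_eq he h'
  obtain ⟨rfl, rfl⟩ := polygonSide_injective (hlm.lt hi) (hlm'.lt hi') heq
  exact ⟨l, m, hlm, hlm'⟩

/-- The child has a side on its own level `j' + 1`, and the parent has sides only on levels up to
`j'`. -/
theorem IsChild.levelTriangle_ne {j i j' i' : ℕ} (h : IsChild j i j' i') (hi : i < levelCard j)
    (hi' : i' < levelCard j') : levelTriangle j i ≠ levelTriangle j' i' := by
  intro heq
  obtain ⟨rfl, -⟩ := h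
  have hs : HasSide (j' + 1) i (j' + 1) (2 * i) := Or.inr ⟨rfl, by omega⟩
  have hsub := polygonSide_subset hs
  rw [heq] at hsub
  obtain ⟨l, m, hlm, he⟩ := exists_side_eq (card_polygonSide _ _) hsub
  obtain ⟨rfl, rfl⟩ := polygonSide_injective (hs.lt hi) (hlm.lt hi') he
  cases j' <;> simp only [HasSide] at hlm <;> omega

/-- Equal triangles share a side, so their positions are equal or parent and child; the latter was
excluded. -/
theorem levelTriangle_injective {j i j' i' : ℕ} (hi : i < levelCard j) (hi' : i' < levelCard j')
    (h : levelTriangle j i = levelTriangle j' i') : j = j' ∧ i = i' := by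
  obtain ⟨l, m, hlm⟩ : ∃ l m, HasSide j i l m := by
    cases j with
    | zero => exact ⟨0, 0, rfl, by norm_num⟩
    | succ j => exact ⟨j, i, Or.inl ⟨rfl, rfl⟩⟩
  have hsub := polygonSide_subset hlm
  obtain ⟨l, m, h1, h2⟩ := exists_common_side hi hi' (card_polygonSide _ _) hsub (h ▸ hsub)
  rcases eq_or_isChild_of_side hi hi' h1 h2 with h3 | h3 | h3
  · exact h3
  · exact (h3.levelTriangle_ne hi hi' h).elim
  · exact (h3.levelTriangle_ne hi' hi h.symm).elim

/-- The positions of the triangles of the recursive triangulation. -/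
@[ext]
structure Position (k : ℕ) where
  /-- the depth of the triangle -/
  level : ℕ
  /-- the number of the triangle within its level -/
  index : ℕ
  level_le : level ≤ k
  index_lt : index < levelCard level

namespace Position

variable {k : ℕ}

/-- The position of the central triangle. -/
def root (k : ℕ) : Position k := ⟨0, 0, Nat.zero_le k, Nat.one_pos⟩

/-- The number of a triangle's parent within its level. -/
def parentIndex : ℕ → ℕ → ℕ
  | 0, _ => 0
  | 1, _ => 0
  | _ + 2, i => i / 2

theorem parentIndex_lt {j i : ℕ} (hi : i < levelCard j) :
    parentIndex j i < levelCard (j - 1) := by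
  match j with
  | 0 => exact Nat.one_pos
  | 1 => exact Nat.one_pos
  | j + 2 =>
    rw [levelCard, pow_double] at hi
    change i / 2 < 3 * 2 ^ j
    omega

/-- The position of the parent; the root is its own parent. -/
def parent (p : Position k) : Position k :=
  ⟨p.level - 1, parentIndex p.level p.index, (Nat.sub_le _ _).trans p.level_le,
    parentIndex_lt p.index_lt⟩

theorem eq_root_iff {p : Position k} : p = root k ↔ p.level = 0 := by
  refine ⟨fun h => h ▸ rfl, fun h => Position.ext h ?_⟩
  have := p.index_lt
  rw [h] at this
  exact Nat.lt_one_iff.1 this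

theorem isChild_iff {p q : Position k} :
    IsChild p.level p.index q.level q.index ↔ p ≠ root k ∧ p.parent = q := by
  rw [Ne, eq_root_iff, Position.ext_iff]
  obtain ⟨j, i, hj, hi⟩ := p
  obtain ⟨j', i', hj', hi'⟩ := q
  simp only [IsChild, parent]
  match j with
  | 0 => simp
  | 1 =>
    simp only [parentIndex]
    constructor
    · rintro ⟨h, -⟩
      obtain rfl : j' = 0 := by omega
      have : i' < 1 := hi'
      omega
    · rintro ⟨-, h, -⟩
      omega
  | j + 2 =>
    simp only [parentIndex]
    omega

/-- The positions correspond to the triangles. -/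
noncomputable def equivTriangles (k : ℕ) : Position k ≃ triangles (recursiveModel k) :=
  Equiv.ofBijective
    (fun p => ⟨levelTriangle p.level p.index, by
      rw [triangles_recursiveModel]
      exact mem_recursiveTriangles_iff.2 ⟨_, _, p.level_le, p.index_lt, rfl⟩⟩) (by
    constructor
    · intro p q h
      exact Position.ext_iff.2
        (levelTriangle_injective p.index_lt q.index_lt (congrArg Subtype.val h))
    · rintro ⟨T, hT⟩
      rw [triangles_recursiveModel] at hT
      obtain ⟨j, i, hj, hi, rfl⟩ := mem_recursiveTriangles_iff.1 hT
      exact ⟨⟨j, i, hj, hi⟩, rfl⟩)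

theorem adj_equivTriangles {p q : Position k} :
    (dualGraph (recursiveModel k)).Adj (equivTriangles k p) (equivTriangles k q) ↔
      (p ≠ root k ∧ p.parent = q) ∨ (q ≠ root k ∧ q.parent = p) := by
  rw [← isChild_iff, ← isChild_iff]
  constructor
  · rintro ⟨hne, e, -, he, h1, h2⟩
    obtain ⟨l, m, h3, h4⟩ := exists_common_side p.index_lt q.index_lt he h1 h2
    refine (eq_or_isChild_of_side p.index_lt q.index_lt h3 h4).resolve_left fun h => hne ?_
    rw [Position.ext_iff.2 h]
  · have key : ∀ p q : Position k, IsChild p.level p.index q.level q.index →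
        (dualGraph (recursiveModel k)).Adj (equivTriangles k p) (equivTriangles k q) := by
      intro p q h
      obtain ⟨l, m, h3, h4⟩ := h.exists_side p.index_lt
      refine ⟨fun heq => h.levelTriangle_ne p.index_lt q.index_lt (congrArg Subtype.val heq),
        polygonSide l m, ?_, card_polygonSide l m, polygonSide_subset h3, polygonSide_subset h4⟩
      exact (recursiveModel k).down_closed (equivTriangles k p).2.1 (polygonSide_subset h3)
        (Finset.card_pos.1 (by rw [card_polygonSide]; norm_num))
    rintro (h | h)
    · exact key p q h
    · exact (key q p h).symm

theorem ncard_children_root (hk : 0 < k) :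
    {p : Position k | p ≠ root k ∧ p.parent = root k}.ncard = 3 := by
  rw [Set.ncard_eq_three]
  refine ⟨⟨1, 0, hk, by simp [levelCard]⟩, ⟨1, 1, hk, by simp [levelCard]⟩,
    ⟨1, 2, hk, by simp [levelCard]⟩, ?_, ?_, ?_, ?_⟩
  · simp [Position.ext_iff]
  · simp [Position.ext_iff]
  · simp [Position.ext_iff]
  · ext p
    rw [Set.mem_ofPred_eq, ← isChild_iff]
    simp only [Set.mem_insert_iff, Set.mem_singleton_iff, Position.ext_iff, root, IsChild,
      true_or, and_true]
    have hp := p.index_lt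
    constructor
    · intro h
      rw [h] at hp
      simp only [levelCard] at hp
      omega
    · omega

theorem ncard_children {q : Position k} (hq : q ≠ root k) (hk : q.level < k) :
    {p : Position k | p ≠ root k ∧ p.parent = q}.ncard = 2 := by
  rw [Ne, eq_root_iff] at hq
  obtain ⟨j, i, hj, hi⟩ := q
  obtain ⟨j, rfl⟩ := Nat.exists_eq_add_one_of_ne_zero hq
  have hi' : i < 3 * 2 ^ j := hi
  rw [Set.ncard_eq_two]
  refine ⟨⟨j + 2, 2 * i, hk, by simp only [levelCard, pow_double]; omega⟩,
    ⟨j + 2, 2 * i + 1, hk, by simp only [levelCard, pow_double]; omega⟩, ?_, ?_⟩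
  · simp [Position.ext_iff]
  · ext p
    rw [Set.mem_ofPred_eq, ← isChild_iff]
    simp only [Set.mem_insert_iff, Set.mem_singleton_iff, Position.ext_iff, IsChild]
    omega

/-- The positions as pairs of a level and a number within the level. -/
def equivSigma (k : ℕ) : Position k ≃ Σ j : Fin (k + 1), Fin (levelCard j) where
  toFun p := ⟨⟨p.level, Nat.lt_succ_of_le p.level_le⟩, ⟨p.index, p.index_lt⟩⟩
  invFun p := ⟨p.1, p.2, Nat.le_of_lt_succ p.1.2, p.2.2⟩
  left_inv _ := rfl
  right_inv _ := rfl

instance : Finite (Position k) := Finite.of_equiv _ (equivSigma k).symm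

theorem card_eq (k : ℕ) : Nat.card (Position k) = 3 * (2 ^ k - 1) + 1 := by
  rw [Nat.card_congr (equivSigma k), Nat.card_eq_fintype_card, Fintype.card_sigma]
  simp only [Fintype.card_fin]
  rw [Fin.sum_univ_eq_sum_range]
  induction k with
  | zero => simp [levelCard]
  | succ k ih =>
    rw [Finset.sum_range_succ, ih, levelCard, pow_succ]
    have : 0 < 2 ^ k := by positivity
    omega

end Position

theorem numTriangles_recursiveModel (k : ℕ) :
    numTriangles (recursiveModel k) = 3 * (2 ^ k - 1) + 1 := by
  rw [← Position.card_eq, Nat.card_congr (Position.equivTriangles k)]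
  rfl

theorem isCompleteCubicTree_recursiveModel (k : ℕ) :
    IsCompleteCubicTree (dualGraph (recursiveModel k)) k := by
  set φ := Position.equivTriangles k with hφ
  have : Finite (triangles (recursiveModel k)) := Finite.of_equiv _ φ
  have himage : ∀ q : Position k, {T | T ≠ φ (Position.root k) ∧ φ (φ.symm T).parent = φ q} =
      φ '' {p | p ≠ Position.root k ∧ p.parent = q} := by
    intro q
    ext T
    obtain ⟨p, rfl⟩ := φ.surjective T
    simp
  refine isCompleteCubicTree_of_parent (depth := fun T => (φ.symm T).level)
    (par := fun T => φ (φ.symm T).parent) (r := φ (Position.root k)) ?_ ?_ ?_ ?_ ?_ ?_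
  · simp only [Equiv.symm_apply_apply]
    rfl
  · intro T hT
    obtain ⟨p, rfl⟩ := φ.surjective T
    have hp : p ≠ Position.root k := fun h => hT (h ▸ rfl)
    rw [Ne, Position.eq_root_iff] at hp
    simp only [Equiv.symm_apply_apply]
    change p.level = p.level - 1 + 1
    omega
  · intro T T'
    obtain ⟨p, rfl⟩ := φ.surjective T
    obtain ⟨q, rfl⟩ := φ.surjective T'
    rw [hφ, Position.adj_equivTriangles]
    simp
  · intro T
    exact (φ.symm T).level_le
  · intro hk
    rw [himage, Set.ncard_image_of_injective _ φ.injective, Position.ncard_children_root hk]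
  · intro T hT hk
    obtain ⟨q, rfl⟩ := φ.surjective T
    simp only [Equiv.symm_apply_apply] at hk
    rw [himage, Set.ncard_image_of_injective _ φ.injective,
      Position.ncard_children (fun h => hT (h ▸ rfl)) hk]

end DualTree

end TriangleStrips
-- The main theorem
theorem theorem3 :
    ∃ M : ℕ → Geometry.SimplicialComplex ℝ (EuclideanSpace ℝ (Fin 2)),
      (∀ k : ℕ,
        TriangleStrips.IsTriangulatedModel (M k) ∧
        TriangleStrips.triangles (M k) = TriangleStrips.recursiveTriangles k ∧
        (M k).space = convexHull ℝ
          (Set.range fun i : Fin (3 * 2 ^ k) => TriangleStrips.polygonVertex (3 * 2 ^ k) i) ∧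
        Nonempty ((M k).space ≃ₜ TriangleStrips.sphereWithHole) ∧
        TriangleStrips.IsCompleteCubicTree (TriangleStrips.dualGraph (M k)) k ∧
        TriangleStrips.numTriangles (M k) = 3 * (2 ^ k - 1) + 1) ∧
      ∃ C : ℝ, ∀ (k : ℕ) (L : Geometry.SimplicialComplex ℝ (EuclideanSpace ℝ (Fin 2))),
        TriangleStrips.IsSubdivision L (M k) →
        ∀ (s t : TriangleStrips.triangles L) (p : (TriangleStrips.dualGraph L).Walk s t),
          TriangleStrips.IsSingleStrip L p →
            3 * (TriangleStrips.numTriangles (M k) : ℝ)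
                - 4 * Real.logb 2 (TriangleStrips.numTriangles (M k)) - C
              ≤ (p.support.length : ℝ) := by
  -- The constant `C = 2` is the additive `2` of `strip_length_ge`, due to the `2(n - 1)` darts of
  -- the tree.
  refine ⟨TriangleStrips.recursiveModel, fun k =>
    ⟨TriangleStrips.isTriangulatedModel_recursiveModel k,
      TriangleStrips.triangles_recursiveModel k, TriangleStrips.space_recursiveModel k,
      TriangleStrips.nonempty_homeomorph_sphereWithHole k,
      TriangleStrips.isCompleteCubicTree_recursiveModel k,
      TriangleStrips.numTriangles_recursiveModel k⟩, 2, ?_⟩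
  intro k L hL s t p hp
  have hfin : L.vertices.Finite := by
    rw [Geometry.SimplicialComplex.vertices_eq]
    exact hL.1.biUnion fun T _ => T.finite_toSet
  obtain ⟨f, hf⟩ := TriangleStrips.exists_injOn_linear hfin
  have hlen := TriangleStrips.strip_length_ge (by simp)
    (TriangleStrips.isTriangulatedModel_recursiveModel k) hL
    (TriangleStrips.isCompleteCubicTree_recursiveModel k) hf hp
  have hnum := TriangleStrips.numTriangles_recursiveModel k
  -- Here `n = 3 * 2 ^ k - 2 ≥ 2 ^ k`, which turns `4 * k` into at most `4 * log₂ n`.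
  have hpow : 2 ^ k ≤ TriangleStrips.numTriangles (TriangleStrips.recursiveModel k) := by
    have : 0 < 2 ^ k := by positivity
    omega
  generalize TriangleStrips.numTriangles (TriangleStrips.recursiveModel k) = n at *
  have hpow' : (2 : ℝ) ^ k ≤ n := by exact_mod_cast hpow
  have hlog : (k : ℝ) ≤ Real.logb 2 n := by
    rw [Real.le_logb_iff_rpow_le one_lt_two (lt_of_lt_of_le (by positivity) hpow'),
      Real.rpow_natCast]
    exact hpow'
  have hlen' : 3 * (n : ℝ) ≤ p.support.length + 4 * k + 2 := by exact_mod_cast hlen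
  linarith
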